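/- Let $X$ and $S$ be independent random variables with $P(X>0)=P(S>0)=1$, $E X<\infty$, $E S<\infty$ and $P(X>S)>0$. Consider the bufferless single-server GI/GI/1/1 system with preemption and push-out on the time axis $\mathbb R$: messages $n\in\mathbb Z$ arrive at times $T_n$, numbered so that $T_0\le 0<T_1$ almost surely; the interarrival times $T_{n+1}-T_n$, $n\ne 0$, are i.i.d. copies of $X$ (the interval $(T_0,T_1]$ that straddles the origin is unrestricted); the service times $S_n$, $n\in\mathbb Z$, are i.i.d. copies of $S$; and the sequence $(S_n)_n$ is independent of the sequence $(T_n)_n$. Each arriving message starts service at once, pushing out any message still in service; so message $n$ departs, at time $T_n+S_n$, if $T_n+S_n<T_{n+1}$, and otherwise it never departs. Let $A(t)$ and $D(t)$ be the largest arrival time $\le t$ and the largest departure time $\le t$, and let $$\Delta(t)=A(t)-A(D(t))$$ be the relative age of information. Then its stationary average is $$\overline\Delta=\frac{E(X\wedge S)}{P(X>S)},$$ in both of the following senses. (a) Almost surely, $\Delta$ is integrable on $[0,t]$ for every $t\ge 0$, and $$\lim_{t\to\infty}\frac1t\int_0^t\Delta(u)\,du=\frac{E(X\wedge S)}{P(X>S)}.$$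 (b) If the process $(\Delta(t))_{t\in\mathbb R}$ is strictly stationary, then for every $t\in\mathbb R$ the variable $\Delta(t)$ is integrable and $$E\,\Delta(t)=\frac{E(X\wedge S)}{P(X>S)}.$$ -/

import Mathlib

open MeasureTheory ProbabilityTheory Filter Topology

/-- `A(t)`: the largest message arrival time that is `≤ t`, where message `n` arrives at `T n`. -/
noncomputable def lastArrival (T : ℤ → ℝ) (t : ℝ) : ℝ :=
  sSup {a : ℝ | (∃ n : ℤ, a = T n) ∧ a ≤ t}

/-- The departure times of the bufferless single server with preemption and push-out. Message `n`
arrives at `T n`, enters service at once (pushing out any message that is still in service) and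
needs the service time `S n`. It departs, at time `T n + S n`, if this is before the next arrival
`T (n + 1)`; otherwise message `n + 1` pushes it out and it never departs. -/
def departureTimes (T S : ℤ → ℝ) : Set ℝ :=
  {d : ℝ | ∃ n : ℤ, T n + S n < T (n + 1) ∧ d = T n + S n}

/-- `D(t)`: the largest message departure time that is `≤ t`. -/
noncomputable def lastDeparture (T S : ℤ → ℝ) (t : ℝ) : ℝ :=
  sSup {d : ℝ | d ∈ departureTimes T S ∧ d ≤ t}

/-- The relative age of information `Δ(t) = A(t) - A(D(t))`. -/
noncomputable def relativeAge (T S : ℤ → ℝ) (t : ℝ) : ℝ :=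
  lastArrival T t - lastArrival T (lastDeparture T S t)

/-- The random data of a GI/GI/1/1 system on the time axis `ℝ`, with the laws of the generic
interarrival time `X` and of the generic service time `Y`: message `n` arrives at `T n` and has
service time `S n`. The messages are numbered so that `T 0 ≤ 0 < T 1`. All interarrival times
except the one that straddles the time origin are i.i.d. copies of `X`; the interval
`(T 0, T 1]` is left unrestricted (in the event-stationary system it is one more
copy of `X` starting at `T 0 = 0`, in the time-stationary system it is length-biased). -/
structure IsGIGISystem {Ω Ω' : Type*} [MeasurableSpace Ω] [MeasurableSpace Ω']
    (P : Measure Ω) (T S : ℤ → Ω → ℝ) (Q : Measure Ω') (X Y : Ω' → ℝ) : Prop where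
  measurable_arrival : ∀ n : ℤ, Measurable (T n)
  measurable_service : ∀ n : ℤ, Measurable (S n)
  origin : ∀ᵐ ω ∂P, T 0 ω ≤ 0 ∧ 0 < T 1 ω
  interarrival_indep :
    iIndepFun (fun (n : {n : ℤ // n ≠ 0}) (ω : Ω) => T (n.1 + 1) ω - T n.1 ω) P
  interarrival_law :
    ∀ n : ℤ, n ≠ 0 → IdentDistrib (fun ω => T (n + 1) ω - T n ω) X P Q
  service_indep : iIndepFun S P
  service_law : ∀ n : ℤ, IdentDistrib (S n) Y P Q
  arrival_indep_service :
    IndepFun (fun (ω : Ω) (n : ℤ) => T n ω) (fun (ω : Ω) (n : ℤ) => S n ω) P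

/-- A real-valued process on the time axis `ℝ` is (strictly) stationary: its law on path space
`ℝ → ℝ` (product σ-algebra, so equivalently its family of finite-dimensional distributions) is
invariant under all time shifts. -/
def IsStationaryProcess {Ω : Type*} [MeasurableSpace Ω] (P : Measure Ω) (Z : ℝ → Ω → ℝ) : Prop :=
  ∀ h : ℝ, P.map (fun (ω : Ω) (t : ℝ) => Z (t + h) ω) = P.map (fun (ω : Ω) (t : ℝ) => Z t ω)

/-!
Why the limit is `E(X ∧ S) / P(X > S)`. Let message `m` have interarrival time `xₘ = Tₘ₊₁ - Tₘ` and
service time `sₘ`, let `wₘ = xₘ ∧ sₘ` be the time it spends in service, and let `βₘ = Δ(Tₘ)`. On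
`[Tₘ, Tₘ₊₁)` the relative age equals `βₘ` as long as message `m` is in service and vanishes
afterwards, so its integral over this interval is `βₘ wₘ`
(`IsRegularPath.integral_relativeAge_interarrival`). Moreover `βₘ₊₁ = xₘ + 1{xₘ ≤ sₘ} βₘ`
(`IsRegularPath.relativeAge_arrival_succ`).

Hence it suffices to average `βₘ wₘ` over the arrivals. Only first moments are available, and the
`βₘ` are not stationary, because the interval that straddles the origin is arbitrary; so the averages
are compared with Birkhoff averages on the space of i.i.d. sequences `(xₙ, sₙ)ₙ`
(`ae_tendsto_age_average`). With `F` the total time in service from a message up to the first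
success, which satisfies `Fₘ = wₘ + 1{xₘ ≤ sₘ} Fₘ₊₁`, one has
`βₘ wₘ = xₘ Fₘ₊₁ + βₘ Fₘ - βₘ₊₁ Fₘ₊₁`, whose sum telescopes. Thus the averages are asymptotically at
most the Birkhoff averages of `xₘ Fₘ₊₁`, which converge to
`E X · E F = E X · E(X ∧ S) / P(X > S)`. They are at least the Birkhoff averages of the contributions
of the last `k` interarrival times, whose means increase to the same number with `k`. Division by
the average interarrival time `E X` gives (a).

The convergence of Birkhoff averages is the pointwise ergodic theorem for ergodic maps
(`ae_tendsto_birkhoffSum_div`), and the shift is ergodic by Kolmogorov's zero-one law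
(`ergodic_seqShift`). For (b), stationarity makes the mean of `Δ(t)` that of its time averages, and
(a) together with Fatou's lemma, applied also to truncations, identifies it
(`lintegral_eq_of_tendsto_time_average`).
-/

/-! ### The pointwise ergodic theorem for ergodic maps -/

section Ergodic

variable {α : Type*} {θ : α → α} {g : α → ℝ}

/-- `maxErgodicSum θ g n x` is the largest of the Birkhoff sums `S₀ = 0, S₁, …, Sₙ` of `g` at `x`,
defined by its recursion along the orbit. -/
def maxErgodicSum (θ : α → α) (g : α → ℝ) : ℕ → α → ℝ
  | 0 => fun _ => 0
  | n + 1 => fun x => max 0 (g x + maxErgodicSum θ g n (θ x))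

lemma maxErgodicSum_nonneg (n : ℕ) (x : α) : 0 ≤ maxErgodicSum θ g n x := by
  cases n with
  | zero => exact le_rfl
  | succ n => exact le_max_left _ _

lemma maxErgodicSum_le_succ (n : ℕ) (x : α) :
    maxErgodicSum θ g n x ≤ maxErgodicSum θ g (n + 1) x := by
  induction n generalizing x with
  | zero => exact maxErgodicSum_nonneg 1 x
  | succ n ih => exact max_le_max le_rfl (add_le_add le_rfl (ih (θ x)))

lemma birkhoffSum_le_maxErgodicSum (n : ℕ) (x : α) :
    birkhoffSum θ g n x ≤ maxErgodicSum θ g n x := by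
  induction n generalizing x with
  | zero => simp [maxErgodicSum]
  | succ n ih =>
    rw [birkhoffSum_succ']
    exact (add_le_add le_rfl (ih (θ x))).trans (le_max_right _ _)

lemma bddAbove_maxErgodicSum_comp_iff (x : α) :
    BddAbove (Set.range fun n => maxErgodicSum θ g n (θ x)) ↔
      BddAbove (Set.range fun n => maxErgodicSum θ g n x) := by
  constructor
  · rintro ⟨C, hC⟩
    refine ⟨max 0 (g x + C), ?_⟩
    rintro _ ⟨n, rfl⟩
    exact (maxErgodicSum_le_succ n x).trans
      (max_le_max le_rfl (add_le_add le_rfl (hC ⟨n, rfl⟩)))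
  · rintro ⟨C, hC⟩
    refine ⟨C - g x, ?_⟩
    rintro _ ⟨n, rfl⟩
    have := (le_max_right 0 (g x + maxErgodicSum θ g n (θ x))).trans (hC ⟨n + 1, rfl⟩)
    simp only
    linarith

variable [MeasurableSpace α] {μ : Measure α}

lemma measurable_maxErgodicSum (hθ : Measurable θ) (hg : Measurable g) (n : ℕ) :
    Measurable (maxErgodicSum θ g n) := by
  induction n with
  | zero => exact measurable_const
  | succ n ih => exact measurable_const.max (hg.add (ih.comp hθ))

lemma integrable_maxErgodicSum [IsFiniteMeasure μ] (hθ : MeasurePreserving θ μ μ)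
    (hg : Integrable g μ) (n : ℕ) : Integrable (maxErgodicSum θ g n) μ := by
  induction n with
  | zero => exact integrable_zero _ _ _
  | succ n ih =>
    exact (integrable_zero _ _ _).sup (hg.add (hθ.integrable_comp_of_integrable ih))

/-- The maximal ergodic lemma, in the case where the Birkhoff sums are almost surely unbounded
above. The increments `Mₙ₊₁ - Mₙ ∘ θ = max (-(Mₙ ∘ θ)) g` have nonnegative integrals, because `Mₙ`
increases with `n` and `θ` preserves `μ`; they are dominated by `|g|` and converge to `g`. -/
lemma integral_nonneg_of_maxErgodicSum_unbounded [IsFiniteMeasure μ]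
    (hθ : MeasurePreserving θ μ μ) (hg : Integrable g μ)
    (h : ∀ᵐ x ∂μ, ¬ BddAbove (Set.range fun n => maxErgodicSum θ g n x)) :
    0 ≤ ∫ x, g x ∂μ := by
  have hM := integrable_maxErgodicSum hθ hg
  have hlim : Tendsto
      (fun n => ∫ x, (maxErgodicSum θ g (n + 1) x - maxErgodicSum θ g n (θ x)) ∂μ) atTop
      (𝓝 (∫ x, g x ∂μ)) := by
    refine tendsto_integral_of_dominated_convergence (fun x => |g x|)
      (fun n => ((hM (n + 1)).sub (hθ.integrable_comp_of_integrable (hM n))).aestronglyMeasurable)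
      hg.abs (fun n => ae_of_all _ fun x => ?_) ?_
    · have h0 := maxErgodicSum_nonneg (θ := θ) (g := g) n (θ x)
      rw [Real.norm_eq_abs]
      simp only [maxErgodicSum]
      rcases max_cases 0 (g x + maxErgodicSum θ g n (θ x)) with ⟨h1, h2⟩ | ⟨h1, h2⟩ <;> rw [h1]
      · rw [abs_le]; constructor <;> cases abs_cases (g x) <;> linarith
      · rw [add_sub_cancel_right]
    · filter_upwards [h] with x hx
      refine tendsto_const_nhds.congr' ?_
      obtain ⟨N, hN⟩ : ∃ N, 0 < maxErgodicSum θ g N x := by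
        by_contra! hc
        exact hx ⟨0, by rintro _ ⟨n, rfl⟩; exact hc n⟩
      have hmono : Monotone fun n => maxErgodicSum θ g n x :=
        monotone_nat_of_le_succ fun n => maxErgodicSum_le_succ n x
      filter_upwards [eventually_ge_atTop N] with n hn
      have h1 : 0 < maxErgodicSum θ g (n + 1) x := hN.trans_le (hmono (by lia))
      simp only [maxErgodicSum] at h1 ⊢
      rcases max_cases 0 (g x + maxErgodicSum θ g n (θ x)) with ⟨h2, _⟩ | ⟨h2, _⟩
      · rw [h2] at h1; exact absurd h1 (lt_irrefl _)
      · rw [h2]; ring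
  refine ge_of_tendsto' hlim fun n => ?_
  have h1 := integral_sub (hM (n + 1)) (hθ.integrable_comp_of_integrable (hM n))
  simp only [Function.comp_apply] at h1
  have h2 : ∫ x, maxErgodicSum θ g n (θ x) ∂μ = ∫ x, maxErgodicSum θ g n x ∂μ := by
    rw [← integral_map hθ.measurable.aemeasurable, hθ.map_eq]
    rw [hθ.map_eq]; exact (hM n).aestronglyMeasurable
  rw [h1, h2]
  exact sub_nonneg.2 (integral_mono (hM n) (hM (n + 1)) (maxErgodicSum_le_succ n))

/-- For an ergodic map the event that the Birkhoff sums of `g` are unbounded above is invariant, so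
it is null as soon as `g` has negative integral. -/
lemma ae_bddAbove_maxErgodicSum [IsProbabilityMeasure μ] (hθ : Ergodic θ μ)
    (hgm : Measurable g) (hg : Integrable g μ) (hneg : ∫ x, g x ∂μ < 0) :
    ∀ᵐ x ∂μ, BddAbove (Set.range fun n => maxErgodicSum θ g n x) := by
  have hmeas : MeasurableSet {x | BddAbove (Set.range fun n => maxErgodicSum θ g n x)} :=
    measurableSet_bddAbove_range (measurable_maxErgodicSum hθ.measurable hgm)
  have hinv : θ ⁻¹' {x | BddAbove (Set.range fun n => maxErgodicSum θ g n x)} =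
      {x | BddAbove (Set.range fun n => maxErgodicSum θ g n x)} := by
    ext x; exact bddAbove_maxErgodicSum_comp_iff x
  rcases hθ.toPreErgodic.ae_empty_or_univ hmeas hinv with h | h
  · exfalso
    refine hneg.not_ge (integral_nonneg_of_maxErgodicSum_unbounded hθ.toMeasurePreserving hg ?_)
    filter_upwards [h.mem_iff] with x hx
    exact fun hb => hx.1 hb
  · filter_upwards [h.mem_iff] with x hx
    exact hx.2 trivial

lemma ae_exists_birkhoffSum_le [IsProbabilityMeasure μ] (hθ : Ergodic θ μ)
    (hgm : Measurable g) (hg : Integrable g μ) {a : ℝ} (ha : ∫ x, g x ∂μ < a) :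
    ∀ᵐ x ∂μ, ∃ C : ℝ, ∀ n : ℕ, birkhoffSum θ g n x ≤ a * n + C := by
  have h1 : ∫ x, (g x - a) ∂μ < 0 := by
    rw [integral_sub hg (integrable_const a)]; simpa using ha
  filter_upwards [ae_bddAbove_maxErgodicSum hθ (hgm.sub_const a) (hg.sub (integrable_const a)) h1]
    with x ⟨C, hC⟩
  refine ⟨C, fun n => ?_⟩
  have h2 := (birkhoffSum_le_maxErgodicSum (θ := θ) (g := fun x => g x - a) n x).trans
    (hC ⟨n, rfl⟩)
  simp only [birkhoffSum, Finset.sum_sub_distrib, Finset.sum_const, Finset.card_range,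
    nsmul_eq_mul] at h2 ⊢
  linarith

/-- **Pointwise ergodic theorem** for an ergodic map of a probability space. -/
theorem ae_tendsto_birkhoffSum_div [IsProbabilityMeasure μ] (hθ : Ergodic θ μ)
    (hgm : Measurable g) (hg : Integrable g μ) :
    ∀ᵐ x ∂μ, Tendsto (fun n : ℕ => birkhoffSum θ g n x / n) atTop (𝓝 (∫ x, g x ∂μ)) := by
  have hup : ∀ k : ℕ, ∀ᵐ x ∂μ, ∃ C : ℝ, ∀ n : ℕ,
      birkhoffSum θ g n x ≤ (∫ x, g x ∂μ + 1 / (k + 1)) * n + C := fun k =>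
    ae_exists_birkhoffSum_le hθ hgm hg (lt_add_of_pos_right _ (by positivity))
  have hlo : ∀ k : ℕ, ∀ᵐ x ∂μ, ∃ C : ℝ, ∀ n : ℕ,
      birkhoffSum θ (fun x => -g x) n x ≤ (-∫ x, g x ∂μ + 1 / (k + 1)) * n + C := fun k =>
    ae_exists_birkhoffSum_le hθ hgm.neg hg.neg (by
      rw [integral_neg']; exact lt_add_of_pos_right _ (by positivity))
  filter_upwards [ae_all_iff.2 hup, ae_all_iff.2 hlo] with x h1 h2
  rw [Metric.tendsto_atTop]
  intro ε hε
  obtain ⟨k, hk⟩ := exists_nat_one_div_lt (half_pos hε)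
  obtain ⟨C₁, hC₁⟩ := h1 k
  obtain ⟨C₂, hC₂⟩ := h2 k
  obtain ⟨N, hN⟩ := exists_nat_gt ((|C₁| + |C₂|) / (ε / 2))
  refine ⟨N + 1, fun n hn => ?_⟩
  have hn0 : (0 : ℝ) < n := by exact_mod_cast (by lia : 0 < n)
  have hnN : (N : ℝ) ≤ n := by exact_mod_cast (by lia : N ≤ n)
  rw [div_lt_iff₀ (half_pos hε)] at hN
  have hb : |C₁| + |C₂| < n * (ε / 2) := hN.trans_le (by gcongr)
  have h3 := hC₁ n
  have h4 := hC₂ n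
  simp only [birkhoffSum, Finset.sum_neg_distrib] at h3 h4 ⊢
  have hkn : 1 / ((k : ℝ) + 1) * n < ε / 2 * n := by gcongr
  rw [Real.dist_eq, abs_lt, lt_sub_iff_add_lt, sub_lt_iff_lt_add, lt_div_iff₀ hn0,
    div_lt_iff₀ hn0]
  have := le_abs_self C₁
  have := le_abs_self C₂
  have := abs_nonneg C₁
  have := abs_nonneg C₂
  constructor <;> nlinarith

end Ergodic

/-! ### The shift on sequences of i.i.d. random elements -/

section Shift

variable {E : Type*}

/-- The one-sided shift on sequences. -/
def seqShift (ω : ℕ → E) : ℕ → E := fun n => ω (n + 1)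

lemma seqShift_iterate (k : ℕ) (ω : ℕ → E) : seqShift^[k] ω = fun n => ω (n + k) := by
  induction k generalizing ω with
  | zero => rfl
  | succ k ih =>
    rw [Function.iterate_succ_apply, ih]
    funext n; simp only [seqShift]; congr 1

variable [MeasurableSpace E]

lemma measurable_seqShift : Measurable (seqShift : (ℕ → E) → ℕ → E) := by
  unfold seqShift; fun_prop

variable (μ : Measure E) [IsProbabilityMeasure μ]

lemma measurePreserving_seqShift :
    MeasurePreserving seqShift (Measure.infinitePi fun _ : ℕ => μ)
      (Measure.infinitePi fun _ : ℕ => μ) :=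
  ⟨measurable_seqShift, Measure.map_infinitePi_infinitePi_of_inj (Ω := fun _ : ℕ => E)
    (P := fun _ => μ) Nat.succ_injective⟩

/-- A shift-invariant event belongs to the tail σ-algebra, so Kolmogorov's zero-one law applies. -/
lemma ergodic_seqShift : Ergodic seqShift (Measure.infinitePi fun _ : ℕ => μ) := by
  refine ⟨measurePreserving_seqShift μ, ⟨fun A hA hinv => ?_⟩⟩
  have hind : iIndep (fun n : ℕ => MeasurableSpace.comap (fun ω : ℕ → E => ω n) inferInstance)
      (Measure.infinitePi fun _ : ℕ => μ) :=
    (iIndepFun_infinitePi (P := fun _ : ℕ => μ) (X := fun _ x => x)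
      (fun _ => measurable_id)).iIndep
  have htail : MeasurableSet[limsup (fun n : ℕ =>
      MeasurableSpace.comap (fun ω : ℕ → E => ω n) inferInstance) atTop] A := by
    rw [limsup_eq_iInf_iSup_of_nat, MeasurableSpace.measurableSet_iInf]
    intro k
    have hk : A = (seqShift^[k]) ⁻¹' A := by
      induction k with
      | zero => rfl
      | succ k ih => rw [Function.iterate_succ, Set.preimage_comp, ← ih, hinv]
    rw [hk]
    have hm : Measurable[⨆ i ≥ k, MeasurableSpace.comap (fun ω : ℕ → E => ω i) inferInstance]
        (seqShift^[k] : (ℕ → E) → ℕ → E) := by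
      refine @measurable_pi_lambda _ _ _ (_) _ _ fun n => ?_
      have : (fun ω : ℕ → E => seqShift^[k] ω n) = fun ω => ω (n + k) := by
        funext ω; rw [seqShift_iterate]
      rw [this]
      refine Measurable.mono (comap_measurable fun ω : ℕ → E => ω (n + k)) ?_ le_rfl
      exact le_iSup₂_of_le (n + k) (by lia) le_rfl
    exact hm hA
  rw [eventuallyConst_set]
  rcases measure_zero_or_one_of_measurableSet_limsup_atTop
    (fun n => (measurable_pi_apply n).comap_le) hind htail with h | h
  · right; exact (measure_eq_zero_iff_ae_notMem.1 h)
  · left; exact (prob_compl_eq_zero_iff hA).2 h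

/-- The head and the tail of an i.i.d. sequence are independent, and the tail has the law of the
sequence. -/
lemma map_head_seqShift :
    (Measure.infinitePi fun _ : ℕ => μ).map (fun ω => (ω 0, seqShift ω)) =
      μ.prod (Measure.infinitePi fun _ : ℕ => μ) := by
  have hind : IndepFun (fun ω : ℕ → E => ω 0) seqShift (Measure.infinitePi fun _ : ℕ => μ) := by
    have h := iIndepFun_infinitePi (P := fun _ : ℕ => μ) (X := fun _ x => x)
      (fun _ => measurable_id)
    have h2 := indep_iSup_of_disjoint (S := {0}) (T := Set.Ici 1)
      (fun n : ℕ => (measurable_pi_apply (X := fun _ : ℕ => E) n).comap_le) h.iIndep (by simp)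
    refine indep_of_indep_of_le_left (indep_of_indep_of_le_right h2 ?_) ?_
    · rw [← measurable_iff_comap_le]
      refine @measurable_pi_lambda _ _ _ (_) _ _ fun n => ?_
      refine Measurable.mono (comap_measurable (fun ω : ℕ → E => ω (n + 1))) ?_ le_rfl
      exact le_iSup₂_of_le (n + 1) (by simp) le_rfl
    · exact le_iSup₂_of_le 0 (by simp) le_rfl
  rw [(indepFun_iff_map_prod_eq_prod_map_map (measurable_pi_apply 0).aemeasurable
    measurable_seqShift.aemeasurable).1 hind, Measure.infinitePi_map_eval,
    (measurePreserving_seqShift μ).map_eq]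

variable {μ} {u : E → ℝ} {v : (ℕ → E) → ℝ}

lemma integrable_head_mul_tail (hu : Integrable u μ)
    (hv : Integrable v (Measure.infinitePi fun _ : ℕ => μ)) :
    Integrable (fun ω => u (ω 0) * v (seqShift ω)) (Measure.infinitePi fun _ : ℕ => μ) := by
  have h := hu.mul_prod hv
  rw [← map_head_seqShift μ] at h
  exact h.comp_measurable (by have := measurable_seqShift (E := E); fun_prop)

lemma integral_head_mul_tail (hu : Integrable u μ)
    (hv : Integrable v (Measure.infinitePi fun _ : ℕ => μ)) :
    ∫ ω, u (ω 0) * v (seqShift ω) ∂(Measure.infinitePi fun _ : ℕ => μ) =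
      (∫ x, u x ∂μ) * ∫ ω, v ω ∂(Measure.infinitePi fun _ : ℕ => μ) := by
  have h := hu.mul_prod hv
  rw [← integral_prod_mul, ← map_head_seqShift μ]
  rw [← map_head_seqShift μ] at h
  rw [integral_map (by have := measurable_seqShift (E := E); fun_prop) h.aestronglyMeasurable]

end Shift

/-- If two independent processes consist of independent variables each, then the pairs of their
values at the same index are independent. -/
lemma iIndepFun_prodMk_of_indepFun {Ω ι E F : Type*} [MeasurableSpace Ω] [MeasurableSpace E]
    [MeasurableSpace F] {P : Measure Ω} [IsProbabilityMeasure P] {X : ι → Ω → E} {S : ι → Ω → F}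
    (hXm : ∀ i, Measurable (X i)) (hSm : ∀ i, Measurable (S i))
    (hX : iIndepFun X P) (hS : iIndepFun S P)
    (hXS : IndepFun (fun ω i => X i ω) (fun ω i => S i ω) P) :
    iIndepFun (fun i ω => (X i ω, S i ω)) P := by
  refine iIndepSets.iIndep
    (π := fun i => {A | ∃ a b, MeasurableSet a ∧ MeasurableSet b ∧ X i ⁻¹' a ∩ S i ⁻¹' b = A})
    (fun i => ((hXm i).prodMk (hSm i)).comap_le) ?_ ?_ ?_
  · rintro i _ ⟨a, b, ha, hb, rfl⟩ _ ⟨a', b', ha', hb', rfl⟩ -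
    refine ⟨a ∩ a', b ∩ b', ha.inter ha', hb.inter hb', ?_⟩
    ext ω; simp only [Set.mem_inter_iff, Set.mem_preimage]; tauto
  · intro i
    simp only
    rw [← generateFrom_prod, MeasurableSpace.comap_generateFrom]
    congr 1
    ext A
    constructor
    · rintro ⟨_, ⟨a, ha, b, hb, rfl⟩, rfl⟩
      exact ⟨a, b, ha, hb, rfl⟩
    · rintro ⟨a, b, ha, hb, rfl⟩
      exact ⟨a ×ˢ b, ⟨a, ha, b, hb, rfl⟩, rfl⟩
  · rw [iIndepSets_iff]
    intro s f hf
    choose! a b ha hb hab using hf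
    have h1 : ⋂ i ∈ s, f i = (fun ω i => X i ω) ⁻¹' ((s : Set ι).pi a) ∩
        (fun ω i => S i ω) ⁻¹' ((s : Set ι).pi b) := by
      ext ω
      simp only [Set.mem_iInter, Set.mem_inter_iff, Set.mem_preimage, Set.mem_pi,
        Finset.mem_coe]
      rw [← forall₂_and]
      refine forall₂_congr fun i hi => ?_
      rw [← hab i hi]; rfl
    have h2 : ∀ c : ι → Set E, (fun ω i => X i ω) ⁻¹' ((s : Set ι).pi c) =
        ⋂ i ∈ s, X i ⁻¹' c i := fun c => by ext; simp
    have h3 : ∀ c : ι → Set F, (fun ω i => S i ω) ⁻¹' ((s : Set ι).pi c) =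
        ⋂ i ∈ s, S i ⁻¹' c i := fun c => by ext; simp
    rw [h1, hXS.measure_inter_preimage_eq_mul _ _
      (MeasurableSet.pi s.countable_toSet ha) (MeasurableSet.pi s.countable_toSet hb), h2, h3,
      hX.measure_inter_preimage_eq_mul s ha, hS.measure_inter_preimage_eq_mul s hb,
      ← Finset.prod_mul_distrib]
    refine Finset.prod_congr rfl fun i hi => ?_
    have h4 : IndepFun (X i) (S i) P :=
      hXS.comp (measurable_pi_apply i) (measurable_pi_apply i)
    rw [← hab i hi, h4.measure_inter_preimage_eq_mul _ _ (ha i hi) (hb i hi)]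

/-! ### Averages of the ages over the arrivals -/

lemma ae_summable_and_integrable_tsum {α : Type*} [MeasurableSpace α] {μ : Measure α}
    {f : ℕ → α → ℝ} (hf : ∀ k, Integrable (f k) μ) (hsum : Summable fun k => ∫ x, ‖f k x‖ ∂μ) :
    (∀ᵐ x ∂μ, Summable fun k => f k x) ∧ Integrable (fun x => ∑' k, f k x) μ := by
  have hfin : ∫⁻ x, ∑' k, ‖f k x‖ₑ ∂μ < ⊤ := by
    rw [lintegral_tsum fun k => (hf k).aestronglyMeasurable.enorm]
    simp_rw [← fun k => ofReal_integral_norm_eq_lintegral_enorm (hf k)]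
    rw [← ENNReal.ofReal_tsum_of_nonneg (fun k => integral_nonneg fun x => norm_nonneg _) hsum]
    exact ENNReal.ofReal_lt_top
  have hsumm : ∀ᵐ x ∂μ, Summable fun k => ‖f k x‖ := by
    filter_upwards [ae_lt_top' (AEMeasurable.tsum
      fun k => (hf k).aestronglyMeasurable.enorm) hfin.ne] with x hx
    have h1 : Summable fun k => ‖f k x‖₊ := by
      rw [← ENNReal.tsum_coe_ne_top_iff_summable]; exact hx.ne
    exact NNReal.summable_coe.2 h1
  refine ⟨hsumm.mono fun x hx => hx.of_norm, ?_⟩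
  have hlim : AEStronglyMeasurable (fun x => ∑' k, f k x) μ := by
    refine aestronglyMeasurable_of_tendsto_ae atTop
      (f := fun n x => ∑ k ∈ Finset.range n, f k x) (fun n => ?_) ?_
    · exact (integrable_finsetSum _ fun k _ => hf k).aestronglyMeasurable
    · filter_upwards [hsumm] with x hx
      exact hx.of_norm.hasSum.tendsto_sum_nat
  refine ⟨hlim, lt_of_le_of_lt (lintegral_mono_ae ?_) hfin⟩
  filter_upwards [hsumm] with x hx
  have h1 : Summable fun k => ‖f k x‖₊ := NNReal.summable_coe.1 hx
  simp only [enorm_eq_nnnorm]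
  rw [← ENNReal.coe_tsum h1]
  exact_mod_cast nnnorm_tsum_le h1

section Ages

/-- The time that the message with interarrival time `a.1` and service time `a.2` spends in
service. -/
noncomputable def busyTime (a : ℝ × ℝ) : ℝ := min a.1 a.2

/-- The indicator that the message with interarrival time `a.1` and service time `a.2` is pushed
out. -/
noncomputable def pushedOut (a : ℝ × ℝ) : ℝ := if a.1 ≤ a.2 then 1 else 0

/-- The time that message `k` spends in service, provided that all the messages `0, …, k - 1` are
pushed out, and `0` otherwise. -/
noncomputable def busyAfterPushOuts : ℕ → (ℕ → ℝ × ℝ) → ℝ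
  | 0 => fun ω => busyTime (ω 0)
  | k + 1 => fun ω => pushedOut (ω 0) * busyAfterPushOuts k (seqShift ω)

/-- The total time in service of the messages from number `0` up to the first one that is not
pushed out, that one included; almost surely the series converges. -/
noncomputable def busyUntilSuccess (ω : ℕ → ℝ × ℝ) : ℝ := ∑' k, busyAfterPushOuts k ω

/-- The integral of the relative age over the interarrival interval of message `k`, if the relative
age at the arrival of message `0` vanishes. -/
noncomputable def ageAreaFromZero : ℕ → (ℕ → ℝ × ℝ) → ℝ
  | 0 => fun _ => 0
  | k + 1 => fun ω => ageAreaFromZero k (seqShift ω) +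
      (ω 0).1 * busyAfterPushOuts k (seqShift ω)

lemma pushedOut_nonneg (a : ℝ × ℝ) : 0 ≤ pushedOut a := by
  unfold pushedOut; split_ifs <;> norm_num

lemma measurable_busyTime : Measurable busyTime := measurable_fst.min measurable_snd

lemma measurable_pushedOut : Measurable pushedOut :=
  Measurable.ite (measurableSet_le measurable_fst measurable_snd) measurable_const measurable_const

lemma measurable_busyAfterPushOuts (k : ℕ) : Measurable (busyAfterPushOuts k) := by
  induction k with
  | zero => exact measurable_busyTime.comp (measurable_pi_apply 0)
  | succ k ih =>
    exact (measurable_pushedOut.comp (measurable_pi_apply 0)).mul (ih.comp measurable_seqShift)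

lemma measurable_ageAreaFromZero (k : ℕ) : Measurable (ageAreaFromZero k) := by
  induction k with
  | zero => exact measurable_const
  | succ k ih =>
    exact (ih.comp measurable_seqShift).add ((measurable_pi_apply 0).fst.mul
      ((measurable_busyAfterPushOuts k).comp measurable_seqShift))

lemma busyAfterPushOuts_nonneg {ω : ℕ → ℝ × ℝ} (hω : ∀ n, 0 < (ω n).1 ∧ 0 < (ω n).2) (k : ℕ) :
    0 ≤ busyAfterPushOuts k ω := by
  induction k generalizing ω with
  | zero => exact le_min (hω 0).1.le (hω 0).2.le
  | succ k ih => exact mul_nonneg (pushedOut_nonneg _) (ih fun n => hω (n + 1))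

lemma busyUntilSuccess_nonneg {ω : ℕ → ℝ × ℝ} (hω : ∀ n, 0 < (ω n).1 ∧ 0 < (ω n).2) :
    0 ≤ busyUntilSuccess ω := tsum_nonneg fun k => busyAfterPushOuts_nonneg hω k

lemma busyUntilSuccess_eq {ω : ℕ → ℝ × ℝ} (hω : Summable fun k => busyAfterPushOuts k ω) :
    busyUntilSuccess ω = busyTime (ω 0) + pushedOut (ω 0) * busyUntilSuccess (seqShift ω) := by
  unfold busyUntilSuccess
  rw [hω.tsum_eq_zero_add, ← tsum_mul_left]
  rfl

variable {β : ℕ → ℝ} {ω : ℕ → ℝ × ℝ}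

/-- Summation by parts: at each arrival the age times the remaining service effort until the next
success is a potential, whose increments account for the difference between charging the area to
the message in service and charging it to the interarrival time. -/
lemma sum_age_mul_busyTime_eq
    (hβ : ∀ n, β (n + 1) = (ω n).1 + pushedOut (ω n) * β n)
    (hω : ∀ n, Summable fun k => busyAfterPushOuts k (seqShift^[n] ω)) (n : ℕ) :
    ∑ i ∈ Finset.range n, β i * busyTime (ω i) =
      birkhoffSum seqShift (fun ω => (ω 0).1 * busyUntilSuccess (seqShift ω)) n ω
        + β 0 * busyUntilSuccess ω - β n * busyUntilSuccess (seqShift^[n] ω) := by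
  induction n with
  | zero => simp
  | succ n ih =>
    rw [Finset.sum_range_succ, ih, birkhoffSum_succ, hβ, busyUntilSuccess_eq (hω n),
      Function.iterate_succ_apply']
    have h0 : (seqShift^[n] ω) 0 = ω n := by simp [seqShift_iterate]
    rw [h0]
    ring

/-- The area over the interarrival interval of message `m + k` splits into the part that is due to
the interarrival times of the messages `m, …, m + k - 1` and the part that is due to the age at the
arrival of message `m`. -/
lemma age_mul_busyTime_eq
    (hβ : ∀ n, β (n + 1) = (ω n).1 + pushedOut (ω n) * β n) (m k : ℕ) :
    β (m + k) * busyTime (ω (m + k)) =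
      ageAreaFromZero k (seqShift^[m] ω) + β m * busyAfterPushOuts k (seqShift^[m] ω) := by
  have h0 : ∀ m, (seqShift^[m] ω) 0 = ω m := fun m => by simp [seqShift_iterate]
  induction k generalizing m with
  | zero => simp [ageAreaFromZero, busyAfterPushOuts, h0]
  | succ k ih =>
    have h := ih (m + 1)
    rw [add_right_comm, Function.iterate_succ_apply', hβ m] at h
    rw [← add_assoc, h]
    simp only [ageAreaFromZero, busyAfterPushOuts, h0]
    ring

variable {μ : Measure (ℝ × ℝ)}

lemma integrable_busyTime (hx : Integrable (fun a => a.1) μ) (hs : Integrable (fun a => a.2) μ) :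
    Integrable busyTime μ := hx.inf hs

variable [IsProbabilityMeasure μ]

lemma integrable_pushedOut : Integrable pushedOut μ := by
  refine Integrable.of_bound measurable_pushedOut.aestronglyMeasurable 1 (ae_of_all _ fun a => ?_)
  unfold pushedOut; split_ifs <;> norm_num

lemma integral_pushedOut : ∫ a, pushedOut a ∂μ = 1 - μ.real {a | a.2 < a.1} := by
  have h1 : MeasurableSet {a : ℝ × ℝ | a.1 ≤ a.2} := measurableSet_le measurable_fst measurable_snd
  have h2 : pushedOut = {a : ℝ × ℝ | a.1 ≤ a.2}.indicator 1 := by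
    funext a; simp [pushedOut, Set.indicator]
  have h3 : {a : ℝ × ℝ | a.2 < a.1} = {a : ℝ × ℝ | a.1 ≤ a.2}ᶜ := by ext; simp
  rw [h2, integral_indicator_one h1, h3, probReal_compl_eq_one_sub h1]
  ring

lemma integrable_busyAfterPushOuts (hw : Integrable busyTime μ) (k : ℕ) :
    Integrable (busyAfterPushOuts k) (Measure.infinitePi fun _ : ℕ => μ) := by
  induction k with
  | zero =>
    exact (measurePreserving_eval_infinitePi (fun _ : ℕ => μ) 0).integrable_comp_of_integrable hw
  | succ k ih => exact integrable_head_mul_tail integrable_pushedOut ih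

lemma integral_busyAfterPushOuts (hw : Integrable busyTime μ) (k : ℕ) :
    ∫ ω, busyAfterPushOuts k ω ∂(Measure.infinitePi fun _ : ℕ => μ) =
      (∫ a, pushedOut a ∂μ) ^ k * ∫ a, busyTime a ∂μ := by
  induction k with
  | zero =>
    have h := measurePreserving_eval_infinitePi (fun _ : ℕ => μ) 0
    rw [pow_zero, one_mul]
    conv_rhs => rw [← h.map_eq]
    rw [integral_map (measurable_pi_apply 0).aemeasurable
      measurable_busyTime.aestronglyMeasurable]
    rfl
  | succ k ih =>
    rw [pow_succ', mul_assoc, ← ih]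
    exact integral_head_mul_tail integrable_pushedOut (integrable_busyAfterPushOuts hw k)

lemma integrable_ageAreaFromZero (hx : Integrable (fun a => a.1) μ) (hw : Integrable busyTime μ)
    (k : ℕ) : Integrable (ageAreaFromZero k) (Measure.infinitePi fun _ : ℕ => μ) := by
  induction k with
  | zero => exact integrable_zero _ _ _
  | succ k ih =>
    exact ((measurePreserving_seqShift μ).integrable_comp_of_integrable ih).add
      (integrable_head_mul_tail hx (integrable_busyAfterPushOuts hw k))

lemma integral_ageAreaFromZero (hx : Integrable (fun a => a.1) μ) (hw : Integrable busyTime μ)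
    (k : ℕ) : ∫ ω, ageAreaFromZero k ω ∂(Measure.infinitePi fun _ : ℕ => μ) =
      (∫ a, a.1 ∂μ) * ((∑ i ∈ Finset.range k, (∫ a, pushedOut a ∂μ) ^ i) *
        ∫ a, busyTime a ∂μ) := by
  induction k with
  | zero => simp [ageAreaFromZero]
  | succ k ih =>
    have hθ := measurePreserving_seqShift μ
    have hA := integrable_ageAreaFromZero hx hw k
    have h1 := integral_add (hθ.integrable_comp_of_integrable hA)
      (integrable_head_mul_tail hx (integrable_busyAfterPushOuts hw k))
    have h2 : ∫ ω, ageAreaFromZero k (seqShift ω) ∂(Measure.infinitePi fun _ : ℕ => μ) =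
        ∫ ω, ageAreaFromZero k ω ∂(Measure.infinitePi fun _ : ℕ => μ) := by
      rw [← integral_map hθ.measurable.aemeasurable, hθ.map_eq]
      exact (measurable_ageAreaFromZero k).aestronglyMeasurable
    simp only [Function.comp_apply] at h1
    simp only [ageAreaFromZero]
    rw [h1, h2, ih, integral_head_mul_tail hx (integrable_busyAfterPushOuts hw k),
      integral_busyAfterPushOuts hw, Finset.sum_range_succ]
    ring

lemma ae_forall_pos (hpos : ∀ᵐ a ∂μ, 0 < a.1 ∧ 0 < a.2) :
    ∀ᵐ ω ∂(Measure.infinitePi fun _ : ℕ => μ), ∀ n, 0 < (ω n).1 ∧ 0 < (ω n).2 :=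
  ae_all_iff.2 fun n =>
    (measurePreserving_eval_infinitePi (fun _ : ℕ => μ) n).quasiMeasurePreserving.ae hpos

/-- The expected service effort until the first success is the sum of a geometric series. -/
lemma busyUntilSuccess_integral (hpos : ∀ᵐ a ∂μ, 0 < a.1 ∧ 0 < a.2) (hw : Integrable busyTime μ)
    (hp : 0 < μ.real {a | a.2 < a.1}) :
    (∀ᵐ ω ∂(Measure.infinitePi fun _ : ℕ => μ), Summable fun k => busyAfterPushOuts k ω) ∧
      Integrable busyUntilSuccess (Measure.infinitePi fun _ : ℕ => μ) ∧
      ∫ ω, busyUntilSuccess ω ∂(Measure.infinitePi fun _ : ℕ => μ) =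
        (∫ a, busyTime a ∂μ) / μ.real {a | a.2 < a.1} := by
  have hq0 : 0 ≤ ∫ a, pushedOut a ∂μ := integral_nonneg pushedOut_nonneg
  have hq1 : ∫ a, pushedOut a ∂μ < 1 := by rw [integral_pushedOut]; linarith
  have hnorm : ∀ k, ∫ ω, ‖busyAfterPushOuts k ω‖ ∂(Measure.infinitePi fun _ : ℕ => μ) =
      (∫ a, pushedOut a ∂μ) ^ k * ∫ a, busyTime a ∂μ := fun k => by
    rw [← integral_busyAfterPushOuts hw k]
    refine integral_congr_ae ?_
    filter_upwards [ae_forall_pos hpos] with ω hω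
    exact Real.norm_of_nonneg (busyAfterPushOuts_nonneg hω k)
  have hgeom := (hasSum_geometric_of_lt_one hq0 hq1).mul_right (∫ a, busyTime a ∂μ)
  have hsum : Summable fun k =>
      ∫ ω, ‖busyAfterPushOuts k ω‖ ∂(Measure.infinitePi fun _ : ℕ => μ) := by
    simp_rw [hnorm]; exact hgeom.summable
  obtain ⟨h1, h2⟩ := ae_summable_and_integrable_tsum (integrable_busyAfterPushOuts hw) hsum
  refine ⟨h1, h2, ?_⟩
  have h3 := hasSum_integral_of_summable_integral_norm (integrable_busyAfterPushOuts hw) hsum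
  simp_rw [integral_busyAfterPushOuts hw] at h3
  have h4 := h3.unique hgeom
  unfold busyUntilSuccess
  rw [h4, integral_pushedOut, div_eq_inv_mul]
  ring_nf

/-- The averages over the arrivals of the area below the relative age. From above, the pointwise
ergodic theorem applies to the areas charged to the interarrival times, `xᵢ F(θⁱ⁺¹ω)`; from below,
to the areas that are due to the last `k` interarrival times. -/
theorem ae_tendsto_age_average (hpos : ∀ᵐ a ∂μ, 0 < a.1 ∧ 0 < a.2)
    (hx : Integrable (fun a => a.1) μ) (hs : Integrable (fun a => a.2) μ)
    (hp : 0 < μ.real {a | a.2 < a.1}) :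
    ∀ᵐ ω ∂(Measure.infinitePi fun _ : ℕ => μ), ∀ β : ℕ → ℝ, 0 ≤ β 0 →
      (∀ n, β (n + 1) = (ω n).1 + pushedOut (ω n) * β n) →
      Tendsto (fun n : ℕ => (∑ i ∈ Finset.range n, β i * busyTime (ω i)) / n) atTop
        (𝓝 ((∫ a, a.1 ∂μ) * ((∫ a, busyTime a ∂μ) / μ.real {a | a.2 < a.1}))) := by
  have hw := integrable_busyTime hx hs
  obtain ⟨hFs, hFi, hFe⟩ := busyUntilSuccess_integral hpos hw hp
  have hθ := ergodic_seqShift μ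
  have hFs' : ∀ᵐ ω ∂(Measure.infinitePi fun _ : ℕ => μ), ∀ n,
      Summable fun k => busyAfterPushOuts k (seqShift^[n] ω) :=
    ae_all_iff.2 fun n => (hθ.toMeasurePreserving.iterate n).quasiMeasurePreserving.ae hFs
  have hFm : Measurable busyUntilSuccess := by
    unfold busyUntilSuccess
    exact Measurable.tsum measurable_busyAfterPushOuts
  have hup := ae_tendsto_birkhoffSum_div hθ
    (g := fun ω => (ω 0).1 * busyUntilSuccess (seqShift ω))
    ((measurable_pi_apply 0).fst.mul (hFm.comp measurable_seqShift))
    (integrable_head_mul_tail hx hFi)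
  rw [integral_head_mul_tail hx hFi, hFe] at hup
  have hlo := fun k => ae_tendsto_birkhoffSum_div hθ (measurable_ageAreaFromZero k)
    (integrable_ageAreaFromZero hx hw k)
  filter_upwards [ae_forall_pos hpos, hFs', hup, ae_all_iff.2 hlo] with ω hω hsum hup hlo β h0 hβ
  have hβ0 : ∀ n, 0 ≤ β n := fun n => by
    induction n with
    | zero => exact h0
    | succ n ih =>
      rw [hβ]; exact add_nonneg (hω n).1.le (mul_nonneg (pushedOut_nonneg _) ih)
  have hωn : ∀ n, ∀ i, 0 < (seqShift^[n] ω i).1 ∧ 0 < (seqShift^[n] ω i).2 := fun n i => by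
    rw [seqShift_iterate]; exact hω _
  have hw0 : ∀ n, 0 ≤ busyTime (ω n) := fun n => le_min (hω n).1.le (hω n).2.le
  have hq0 : 0 ≤ ∫ a, pushedOut a ∂μ := integral_nonneg pushedOut_nonneg
  have hq1 : ∫ a, pushedOut a ∂μ < 1 := by rw [integral_pushedOut]; linarith
  refine tendsto_order.2 ⟨fun a ha => ?_, fun a ha => ?_⟩
  · have hgeom : Tendsto (fun k => ∫ ω, ageAreaFromZero k ω ∂(Measure.infinitePi fun _ : ℕ => μ))
        atTop (𝓝 ((∫ a, a.1 ∂μ) * ((∫ a, busyTime a ∂μ) / μ.real {a | a.2 < a.1}))) := by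
      simp_rw [integral_ageAreaFromZero hx hw]
      have h1 := (hasSum_geometric_of_lt_one hq0 hq1).tendsto_sum_nat
      rw [integral_pushedOut, sub_sub_cancel] at h1
      rw [integral_pushedOut, div_eq_inv_mul]
      exact (h1.mul_const _).const_mul _
    obtain ⟨k, hk⟩ := (hgeom.eventually (lt_mem_nhds ha)).exists
    have hratio : Tendsto (fun n : ℕ => (n : ℝ) / (n + k)) atTop (𝓝 1) :=
      tendsto_natCast_div_add_atTop (k : ℝ)
    have h2 := (hlo k).mul hratio
    rw [mul_one] at h2
    rw [← map_add_atTop_eq_nat k, eventually_map]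
    filter_upwards [h2.eventually (lt_mem_nhds hk), eventually_gt_atTop 0] with n hn hn0
    refine hn.trans_le ?_
    have hn0' : (n : ℝ) ≠ 0 := by exact_mod_cast hn0.ne'
    rw [div_mul_div_cancel₀ hn0', Nat.cast_add]
    gcongr
    rw [Nat.add_comm, Finset.sum_range_add]
    refine le_add_of_nonneg_of_le
      (Finset.sum_nonneg fun i _ => mul_nonneg (hβ0 i) (hw0 i)) (Finset.sum_le_sum fun i _ => ?_)
    rw [Nat.add_comm, age_mul_busyTime_eq hβ]
    exact le_add_of_nonneg_right (mul_nonneg (hβ0 _) (busyAfterPushOuts_nonneg (hωn i) k))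
  · have h1 : Tendsto (fun n : ℕ => β 0 * busyUntilSuccess ω / (n : ℝ)) atTop (𝓝 0) :=
      tendsto_const_div_atTop_nhds_zero_nat _
    have h2 := hup.add h1
    rw [add_zero] at h2
    filter_upwards [h2.eventually (gt_mem_nhds ha)] with n hn
    refine lt_of_le_of_lt ?_ hn
    rw [← add_div, sum_age_mul_busyTime_eq hβ hsum]
    gcongr
    exact sub_le_self _ (mul_nonneg (hβ0 n) (busyUntilSuccess_nonneg (hωn n)))

end Ages

/-! ### The path of the relative age -/

section Path

/-- The properties, valid almost surely in a GI/GI/1/1 system, that make the last arrival time and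
the last departure time before any given instant genuine maxima. -/
structure IsRegularPath (T S : ℤ → ℝ) : Prop where
  strictMono : StrictMono T
  tendsto_atTop : Tendsto T atTop atTop
  tendsto_atBot : Tendsto T atBot atBot
  service_pos : ∀ n, 0 < S n
  exists_success_lt : ∀ m, ∃ k < m, T k + S k < T (k + 1)

variable {T S : ℤ → ℝ}

namespace IsRegularPath

lemma exists_interarrival (h : IsRegularPath T S) (t : ℝ) : ∃ m, T m ≤ t ∧ t < T (m + 1) := by
  obtain ⟨a, ha⟩ := (h.tendsto_atBot.eventually (eventually_le_atBot t)).exists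
  obtain ⟨b, hb⟩ := (h.tendsto_atTop.eventually (eventually_gt_atTop t)).exists
  obtain ⟨m, hm, hmax⟩ := Int.exists_greatest_of_bdd (P := fun n => T n ≤ t)
    ⟨b, fun z hz => (h.strictMono.lt_iff_lt.1 (hz.trans_lt hb)).le⟩ ⟨a, ha⟩
  refine ⟨m, hm, ?_⟩
  by_contra! hc
  exact absurd (hmax _ hc) (by lia)

lemma exists_last_success (h : IsRegularPath T S) (m : ℤ) :
    ∃ k < m, T k + S k < T (k + 1) ∧ ∀ j, k < j → j < m → T (j + 1) ≤ T j + S j := by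
  obtain ⟨a, ha⟩ := h.exists_success_lt m
  obtain ⟨k, hk, hmax⟩ := Int.exists_greatest_of_bdd
    (P := fun n => n < m ∧ T n + S n < T (n + 1)) ⟨m, fun z hz => hz.1.le⟩ ⟨a, ha⟩
  refine ⟨k, hk.1, hk.2, fun j hkj hjm => ?_⟩
  by_contra! hc
  exact absurd (hmax j ⟨hjm, hc⟩) (by lia)

lemma isGreatest_arrival (h : IsRegularPath T S) {m : ℤ} {t : ℝ} (h1 : T m ≤ t)
    (h2 : t < T (m + 1)) : IsGreatest {a : ℝ | (∃ n : ℤ, a = T n) ∧ a ≤ t} (T m) := by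
  refine ⟨⟨⟨m, rfl⟩, h1⟩, ?_⟩
  rintro _ ⟨⟨n, rfl⟩, hn⟩
  exact h.strictMono.monotone (Int.lt_add_one_iff.1 (h.strictMono.lt_iff_lt.1 (hn.trans_lt h2)))

lemma lastArrival_eq (h : IsRegularPath T S) {m : ℤ} {t : ℝ} (h1 : T m ≤ t)
    (h2 : t < T (m + 1)) : lastArrival T t = T m :=
  (h.isGreatest_arrival h1 h2).csSup_eq

lemma isGreatest_lastArrival (h : IsRegularPath T S) (t : ℝ) :
    IsGreatest {a : ℝ | (∃ n : ℤ, a = T n) ∧ a ≤ t} (lastArrival T t) := by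
  obtain ⟨m, h1, h2⟩ := h.exists_interarrival t
  rw [h.lastArrival_eq h1 h2]
  exact h.isGreatest_arrival h1 h2

lemma isGreatest_departure_of_le (h : IsRegularPath T S) {m : ℤ} {t : ℝ} (h1 : T m + S m ≤ t)
    (h2 : t < T (m + 1)) :
    IsGreatest {d : ℝ | d ∈ departureTimes T S ∧ d ≤ t} (T m + S m) := by
  refine ⟨⟨⟨m, h1.trans_lt h2, rfl⟩, h1⟩, ?_⟩
  rintro _ ⟨⟨n, hn, rfl⟩, hnt⟩
  rcases lt_trichotomy n m with hnm | rfl | hnm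
  · exact hn.le.trans ((h.strictMono.monotone (Int.add_one_le_iff.2 hnm)).trans
      (le_add_of_nonneg_right (h.service_pos m).le))
  · exact le_rfl
  · have := h.strictMono.monotone (Int.add_one_le_iff.2 hnm)
    linarith [h.service_pos n]

lemma isGreatest_departure_of_lt (h : IsRegularPath T S) {m k : ℤ} {t : ℝ} (h1 : T m ≤ t)
    (h2 : t < T (m + 1)) (h3 : t < T m + S m) (hkm : k < m) (hk : T k + S k < T (k + 1))
    (hlast : ∀ j, k < j → j < m → T (j + 1) ≤ T j + S j) :
    IsGreatest {d : ℝ | d ∈ departureTimes T S ∧ d ≤ t} (T k + S k) := by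
  have h4 := h.strictMono.monotone (Int.add_one_le_iff.2 hkm)
  refine ⟨⟨⟨k, hk, rfl⟩, by linarith⟩, ?_⟩
  rintro _ ⟨⟨n, hn, rfl⟩, hnt⟩
  rcases lt_trichotomy n k with hnk | rfl | hnk
  · have := h.strictMono.monotone (Int.add_one_le_iff.2 hnk)
    linarith [h.service_pos k]
  · exact le_rfl
  · rcases lt_trichotomy n m with hnm | rfl | hnm
    · exact absurd (hlast n hnk hnm) hn.not_ge
    · exact absurd hnt h3.not_ge
    · have := h.strictMono.monotone (Int.add_one_le_iff.2 hnm)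
      linarith [h.service_pos n]

lemma isGreatest_lastDeparture (h : IsRegularPath T S) (t : ℝ) :
    IsGreatest {d : ℝ | d ∈ departureTimes T S ∧ d ≤ t} (lastDeparture T S t) := by
  obtain ⟨m, h1, h2⟩ := h.exists_interarrival t
  obtain ⟨k, hkm, hk, hlast⟩ := h.exists_last_success m
  rcases lt_or_ge t (T m + S m) with h3 | h3
  · have := h.isGreatest_departure_of_lt h1 h2 h3 hkm hk hlast
    rwa [← show lastDeparture T S t = T k + S k from this.csSup_eq] at this
  · have := h.isGreatest_departure_of_le h3 h2
    rwa [← show lastDeparture T S t = T m + S m from this.csSup_eq] at this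

lemma monotone_lastArrival (h : IsRegularPath T S) : Monotone (lastArrival T) := fun s t hst =>
  (h.isGreatest_lastArrival t).2
    ⟨(h.isGreatest_lastArrival s).1.1, (h.isGreatest_lastArrival s).1.2.trans hst⟩

lemma monotone_lastDeparture (h : IsRegularPath T S) : Monotone (lastDeparture T S) :=
  fun s t hst => (h.isGreatest_lastDeparture t).2
    ⟨(h.isGreatest_lastDeparture s).1.1, (h.isGreatest_lastDeparture s).1.2.trans hst⟩

lemma intervalIntegrable_relativeAge (h : IsRegularPath T S) (a b : ℝ) :
    IntervalIntegrable (relativeAge T S) volume a b :=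
  h.monotone_lastArrival.intervalIntegrable.sub
    (h.monotone_lastArrival.comp h.monotone_lastDeparture).intervalIntegrable

lemma relativeAge_nonneg (h : IsRegularPath T S) (t : ℝ) : 0 ≤ relativeAge T S t :=
  sub_nonneg.2 (h.monotone_lastArrival (h.isGreatest_lastDeparture t).1.2)

lemma relativeAge_eq_zero (h : IsRegularPath T S) {m : ℤ} {t : ℝ} (h1 : T m + S m ≤ t)
    (h2 : t < T (m + 1)) : relativeAge T S t = 0 := by
  have h0 := h.service_pos m
  have hd : lastDeparture T S t = T m + S m := (h.isGreatest_departure_of_le h1 h2).csSup_eq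
  rw [relativeAge, hd, h.lastArrival_eq (by linarith) h2,
    h.lastArrival_eq (m := m) (by linarith) (by linarith), sub_self]

lemma relativeAge_eq_sub (h : IsRegularPath T S) {m k : ℤ} {t : ℝ} (h1 : T m ≤ t)
    (h2 : t < T (m + 1)) (h3 : t < T m + S m) (hkm : k < m) (hk : T k + S k < T (k + 1))
    (hlast : ∀ j, k < j → j < m → T (j + 1) ≤ T j + S j) :
    relativeAge T S t = T m - T k := by
  have h0 := h.service_pos k
  have hd : lastDeparture T S t = T k + S k :=
    (h.isGreatest_departure_of_lt h1 h2 h3 hkm hk hlast).csSup_eq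
  rw [relativeAge, hd, h.lastArrival_eq h1 h2,
    h.lastArrival_eq (m := k) (by linarith) hk]

lemma relativeAge_arrival_eq_sub (h : IsRegularPath T S) {m k : ℤ} (hkm : k < m)
    (hk : T k + S k < T (k + 1)) (hlast : ∀ j, k < j → j < m → T (j + 1) ≤ T j + S j) :
    relativeAge T S (T m) = T m - T k :=
  h.relativeAge_eq_sub le_rfl (h.strictMono (lt_add_one m))
    (lt_add_of_pos_right _ (h.service_pos m)) hkm hk hlast

/-- While message `m` is in service the relative age keeps its value at the arrival of `m`. -/
lemma relativeAge_eq_of_busy (h : IsRegularPath T S) {m : ℤ} {t : ℝ} (h1 : T m ≤ t)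
    (h2 : t < T (m + 1)) (h3 : t < T m + S m) :
    relativeAge T S t = relativeAge T S (T m) := by
  obtain ⟨k, hkm, hk, hlast⟩ := h.exists_last_success m
  rw [h.relativeAge_eq_sub h1 h2 h3 hkm hk hlast, h.relativeAge_arrival_eq_sub hkm hk hlast]

/-- At an arrival the relative age grows by the last interarrival time if the previous message has
been pushed out; otherwise it equals that interarrival time. -/
lemma relativeAge_arrival_succ (h : IsRegularPath T S) (m : ℤ) :
    relativeAge T S (T (m + 1)) =
      (T (m + 1) - T m) + pushedOut (T (m + 1) - T m, S m) * relativeAge T S (T m) := by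
  simp only [pushedOut]
  split_ifs with hm
  · obtain ⟨k, hkm, hk, hlast⟩ := h.exists_last_success m
    rw [h.relativeAge_arrival_eq_sub hkm hk hlast,
      h.relativeAge_arrival_eq_sub (m := m + 1) (by lia) hk fun j hkj hj => ?_]
    · ring
    · rcases (Int.lt_add_one_iff.1 hj).lt_or_eq with hjm | rfl
      · exact hlast j hkj hjm
      · linarith
  · rw [h.relativeAge_arrival_eq_sub (k := m) (lt_add_one m) (by linarith)
      fun j h1 h2 => absurd h1 (by lia)]
    ring

lemma integral_relativeAge_interarrival (h : IsRegularPath T S) (m : ℤ) :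
    ∫ u in T m..T (m + 1), relativeAge T S u =
      relativeAge T S (T m) * busyTime (T (m + 1) - T m, S m) := by
  have hT := h.strictMono (lt_add_one m)
  have hS := h.service_pos m
  set c := T m + busyTime (T (m + 1) - T m, S m) with hc
  have hc1 : T m ≤ c := le_add_of_nonneg_right (le_min (sub_nonneg.2 hT.le) hS.le)
  have hc2 : c ≤ T (m + 1) := by
    have : busyTime (T (m + 1) - T m, S m) ≤ T (m + 1) - T m := min_le_left _ _
    linarith
  have hc3 : c ≤ T m + S m := add_le_add le_rfl (min_le_right _ _)
  rw [← intervalIntegral.integral_add_adjacent_intervals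
    (h.intervalIntegrable_relativeAge (T m) c) (h.intervalIntegrable_relativeAge c _)]
  have h1 : ∫ u in T m..c, relativeAge T S u = ∫ _ in T m..c, relativeAge T S (T m) := by
    refine intervalIntegral.integral_congr_Ioo_of_le hc1 fun u hu => ?_
    exact h.relativeAge_eq_of_busy hu.1.le (hu.2.trans_le hc2) (hu.2.trans_le hc3)
  have h2 : ∫ u in c..T (m + 1), relativeAge T S u = ∫ _ in c..T (m + 1), (0 : ℝ) := by
    refine intervalIntegral.integral_congr_Ioo_of_le hc2 fun u hu => ?_
    refine h.relativeAge_eq_zero ?_ hu.2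
    -- As `c < u < T (m + 1)`, the minimum that defines `c` is attained by the service time.
    by_contra! hlt
    have h3 : c = min (T (m + 1)) (T m + S m) := by
      rw [hc, busyTime, ← min_add_add_left, add_sub_cancel]
    exact absurd hu.1 (h3 ▸ (lt_min hu.2 hlt).not_gt)
  rw [h1, h2, intervalIntegral.integral_const, intervalIntegral.integral_zero, hc]
  simp only [add_sub_cancel_left, smul_eq_mul, add_zero]
  ring

lemma integral_relativeAge_arrival (h : IsRegularPath T S) (n : ℕ) :
    ∫ u in (0 : ℝ)..T (n + 1), relativeAge T S u = (∫ u in (0 : ℝ)..T 1, relativeAge T S u) +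
      ∑ i ∈ Finset.range n, relativeAge T S (T (i + 1)) *
        busyTime (T (i + 1 + 1) - T (i + 1), S (i + 1)) := by
  induction n with
  | zero => simp
  | succ n ih =>
    rw [Finset.sum_range_succ, ← add_assoc, ← ih, ← h.integral_relativeAge_interarrival,
      intervalIntegral.integral_add_adjacent_intervals
        (h.intervalIntegrable_relativeAge _ _) (h.intervalIntegrable_relativeAge _ _)]
    simp

/-- The limiting time average of the relative age is the average area per arrival divided by the average
interarrival time: between consecutive arrivals the integral is squeezed by its values at them. -/
lemma tendsto_time_average (h : IsRegularPath T S) {a x : ℝ} (hx : 0 < x)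
    (hsum : Tendsto (fun n : ℕ => (∑ i ∈ Finset.range n, relativeAge T S (T (i + 1)) *
        busyTime (T (i + 1 + 1) - T (i + 1), S (i + 1))) / n) atTop (𝓝 a))
    (hT : Tendsto (fun n : ℕ => (T (n + 1) - T 1) / n) atTop (𝓝 x)) :
    Tendsto (fun t : ℝ => (∫ u in (0 : ℝ)..t, relativeAge T S u) / t) atTop (𝓝 (a / x)) := by
  have hdiv : ∀ c : ℝ, Tendsto (fun n : ℕ => c / (n : ℝ)) atTop (𝓝 0) := fun c =>
    tendsto_const_div_atTop_nhds_zero_nat c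
  have hT' : Tendsto (fun n : ℕ => T (n + 1) / n) atTop (𝓝 x) := by
    have := hT.add (hdiv (T 1))
    rw [add_zero] at this
    refine this.congr fun n => ?_
    rw [← add_div, sub_add_cancel]
  have hR : Tendsto (fun n : ℕ => (∫ u in (0 : ℝ)..T (n + 1), relativeAge T S u) / n) atTop
      (𝓝 a) := by
    have := (hdiv (∫ u in (0 : ℝ)..T 1, relativeAge T S u)).add hsum
    rw [zero_add] at this
    refine this.congr fun n => ?_
    rw [← add_div, ← h.integral_relativeAge_arrival]
  have hratio : Tendsto (fun n : ℕ => (n : ℝ) / ((n + 1 : ℕ) : ℝ)) atTop (𝓝 1) := by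
    simpa using tendsto_natCast_div_add_atTop (1 : ℝ)
  have hratio' : Tendsto (fun n : ℕ => ((n + 1 : ℕ) : ℝ) / (n : ℝ)) atTop (𝓝 1) := by
    have := hratio.inv₀ one_ne_zero
    simpa using this
  have hlo : Tendsto (fun n : ℕ => (∫ u in (0 : ℝ)..T (n + 1), relativeAge T S u) /
      T (n + 1 + 1)) atTop (𝓝 (a / x)) := by
    have h1 := hR.mul hratio
    have h2 := h1.div ((tendsto_add_atTop_iff_nat 1).2 hT') hx.ne'
    rw [mul_one] at h2
    refine h2.congr' ?_
    filter_upwards [eventually_gt_atTop 0] with n hn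
    have hn' : (n : ℝ) ≠ 0 := by exact_mod_cast hn.ne'
    have hn'' : ((n + 1 : ℕ) : ℝ) ≠ 0 := by positivity
    simp only [Pi.div_apply]
    rw [div_mul_div_cancel₀ hn', div_div_div_cancel_right₀ hn'']
    push_cast
    rfl
  have hhi : Tendsto (fun n : ℕ => (∫ u in (0 : ℝ)..T (n + 1 + 1), relativeAge T S u) /
      T (n + 1)) atTop (𝓝 (a / x)) := by
    have h1 := ((tendsto_add_atTop_iff_nat 1).2 hR).mul hratio'
    have h2 := h1.div hT' hx.ne'
    rw [mul_one] at h2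
    refine h2.congr' ?_
    filter_upwards [eventually_gt_atTop 0] with n hn
    have hn' : (n : ℝ) ≠ 0 := by exact_mod_cast hn.ne'
    have hn'' : ((n + 1 : ℕ) : ℝ) ≠ 0 := by positivity
    simp only [Pi.div_apply]
    rw [div_mul_div_cancel₀ hn'', div_div_div_cancel_right₀ hn']
    push_cast
    rfl
  choose m hm1 hm2 using h.exists_interarrival
  have hmtop : Tendsto m atTop atTop := by
    refine Filter.tendsto_atTop.2 fun b => ?_
    filter_upwards [eventually_ge_atTop (T b)] with t ht
    exact Int.lt_add_one_iff.1 (h.strictMono.lt_iff_lt.1 (ht.trans_lt (hm2 t)))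
  have hk : Tendsto (fun t => (m t - 1).toNat) atTop atTop := by
    refine Filter.tendsto_atTop.2 fun b => ?_
    filter_upwards [hmtop.eventually (eventually_ge_atTop ((b : ℤ) + 1))] with t ht
    lia
  have hmk : ∀ᶠ t in atTop, (((m t - 1).toNat : ℕ) : ℤ) + 1 = m t ∧ 0 < T (m t) := by
    filter_upwards [hmtop.eventually (eventually_ge_atTop 1),
      (h.tendsto_atTop.comp hmtop).eventually (eventually_gt_atTop 0)] with t ht ht'
    exact ⟨by lia, ht'⟩
  have hmono : ∀ {s t : ℝ}, s ≤ t →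
      ∫ u in (0 : ℝ)..s, relativeAge T S u ≤ ∫ u in (0 : ℝ)..t, relativeAge T S u :=
    fun {s t} hst => by
      rw [← intervalIntegral.integral_add_adjacent_intervals
        (h.intervalIntegrable_relativeAge 0 s) (h.intervalIntegrable_relativeAge s t)]
      exact le_add_of_nonneg_right
        (intervalIntegral.integral_nonneg hst fun u _ => h.relativeAge_nonneg u)
  have hpos : ∀ {t : ℝ}, 0 ≤ t → 0 ≤ ∫ u in (0 : ℝ)..t, relativeAge T S u := fun ht =>
    intervalIntegral.integral_nonneg ht fun u _ => h.relativeAge_nonneg u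
  refine tendsto_of_tendsto_of_tendsto_of_le_of_le' (hlo.comp hk) (hhi.comp hk) ?_ ?_
  · filter_upwards [hmk] with t ht
    simp only [Function.comp_apply]
    rw [ht.1]
    exact div_le_div₀ (hpos (ht.2.le.trans (hm1 t))) (hmono (hm1 t)) (ht.2.trans_le (hm1 t))
      (hm2 t).le
  · filter_upwards [hmk] with t ht
    simp only [Function.comp_apply]
    rw [ht.1]
    exact div_le_div₀ (hpos (ht.2.trans (h.strictMono (lt_add_one _))).le) (hmono (hm2 t).le)
      ht.2 (hm1 t)

end IsRegularPath

end Path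

/-! ### Almost sure regularity of the paths -/

lemma birkhoffSum_seqShift_eval {E : Type*} (u : E → ℝ) (n : ℕ) (ω : ℕ → E) :
    birkhoffSum seqShift (fun ω => u (ω 0)) n ω = ∑ i ∈ Finset.range n, u (ω i) := by
  simp [birkhoffSum, seqShift_iterate]

/-- The strong law of large numbers on the canonical space of i.i.d. sequences. -/
lemma ae_tendsto_sum_div {E : Type*} [MeasurableSpace E] {μ : Measure E} [IsProbabilityMeasure μ]
    {u : E → ℝ} (hum : Measurable u) (hu : Integrable u μ) :
    ∀ᵐ ω ∂(Measure.infinitePi fun _ : ℕ => μ),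
      Tendsto (fun n : ℕ => (∑ i ∈ Finset.range n, u (ω i)) / n) atTop (𝓝 (∫ a, u a ∂μ)) := by
  have h0 := measurePreserving_eval_infinitePi (fun _ : ℕ => μ) 0
  have h1 : ∫ ω, u (ω 0) ∂(Measure.infinitePi fun _ : ℕ => μ) = ∫ a, u a ∂μ := by
    conv_rhs => rw [← h0.map_eq]
    rw [integral_map (measurable_pi_apply 0).aemeasurable hum.aestronglyMeasurable]
  have h2 := ae_tendsto_birkhoffSum_div (ergodic_seqShift μ) (g := fun ω : ℕ → E => u (ω 0))
    (hum.comp (measurable_pi_apply 0)) (h0.integrable_comp_of_integrable hu)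
  filter_upwards [h2] with ω hω
  rw [h1] at hω
  simpa only [birkhoffSum_seqShift_eval] using hω

lemma ae_exists_success_ge {μ : Measure (ℝ × ℝ)} [IsProbabilityMeasure μ]
    (hp : 0 < μ.real {a | a.2 < a.1}) :
    ∀ᵐ ω ∂(Measure.infinitePi fun _ : ℕ => μ), ∀ N : ℕ, ∃ n ≥ N, (ω n).2 < (ω n).1 := by
  filter_upwards [ae_tendsto_sum_div measurable_pushedOut integrable_pushedOut (μ := μ)] with ω hω N
  by_contra! hc
  have hq1 : ∫ a, pushedOut a ∂μ < 1 := by rw [integral_pushedOut]; linarith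
  refine hq1.not_ge (le_of_tendsto_of_tendsto' (tendsto_natCast_div_add_atTop (N : ℝ))
    ((tendsto_add_atTop_iff_nat N).2 hω) fun n => ?_)
  rw [Nat.cast_add]
  gcongr
  rw [Nat.add_comm, Finset.sum_range_add]
  refine le_add_of_nonneg_of_le (Finset.sum_nonneg fun i _ => pushedOut_nonneg _) ?_
  rw [Finset.sum_congr rfl fun i _ => show pushedOut (ω (N + i)) = 1 from
    if_pos (hc (N + i) (by lia))]
  simp

lemma integral_pos_of_ae_pos {α : Type*} [MeasurableSpace α] {μ : Measure α}
    [IsProbabilityMeasure μ] {f : α → ℝ} (hpos : ∀ᵐ x ∂μ, 0 < f x) (hf : Integrable f μ) :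
    0 < ∫ x, f x ∂μ := by
  rw [integral_pos_iff_support_of_nonneg_ae (hpos.mono fun _ h => h.le) hf]
  have h1 : Function.support f =ᵐ[μ] Set.univ := by
    filter_upwards [hpos] with x hx
    exact propext ⟨fun _ => trivial, fun _ => hx.ne'⟩
  rw [measure_congr h1]
  simp

lemma sum_interarrival_eq_sub {Ω : Type*} (T : ℤ → Ω → ℝ) (ω : Ω) (n : ℕ) :
    ∑ i ∈ Finset.range n, (T ((i : ℤ) + 1 + 1) ω - T ((i : ℤ) + 1) ω) =
      T ((n : ℤ) + 1) ω - T 1 ω := by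
  have := Finset.sum_range_sub (fun i : ℕ => T ((i : ℤ) + 1) ω) n
  simpa using this

section System

variable {Ω Ω' : Type*} [MeasurableSpace Ω] [MeasurableSpace Ω'] {P : Measure Ω}
  [IsProbabilityMeasure P] {T S : ℤ → Ω → ℝ} {Q : Measure Ω'} [IsProbabilityMeasure Q]
  {X Y : Ω' → ℝ}

namespace IsGIGISystem

/-- Along any sequence of distinct message numbers `≠ 0`, the pairs of interarrival time and service
time form an i.i.d. sequence. -/
lemma map_eq_infinitePi (hsys : IsGIGISystem P T S Q X Y) (hXY : IndepFun X Y Q)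
    {f : ℕ → {n : ℤ // n ≠ 0}} (hf : Function.Injective f) :
    P.map (fun ω i => (T ((f i).1 + 1) ω - T (f i).1 ω, S (f i).1 ω)) =
      Measure.infinitePi fun _ : ℕ => Q.map fun ω' => (X ω', Y ω') := by
  have hTm := hsys.measurable_arrival
  have hSm := hsys.measurable_service
  have hind : IndepFun (fun ω (i : ℕ) => T ((f i).1 + 1) ω - T (f i).1 ω)
      (fun ω (i : ℕ) => S (f i).1 ω) P :=
    hsys.arrival_indep_service.comp
      (φ := fun (T : ℤ → ℝ) (i : ℕ) => T ((f i).1 + 1) - T (f i).1)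
      (ψ := fun (S : ℤ → ℝ) (i : ℕ) => S (f i).1)
      (by fun_prop) (by fun_prop)
  have hpair := iIndepFun_prodMk_of_indepFun (fun i => (hTm _).sub (hTm _)) (fun i => hSm _)
    (hsys.interarrival_indep.precomp hf)
    (hsys.service_indep.precomp (Subtype.val_injective.comp hf)) hind
  have h1 := hpair.map_fun_eq_infinitePi_map fun i => ((hTm _).sub (hTm _)).prodMk (hSm _)
  have h2 : ∀ i, P.map (fun ω => (T ((f i).1 + 1) ω - T (f i).1 ω, S (f i).1 ω)) =
      Q.map fun ω' => (X ω', Y ω') := fun i => by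
    have hx := hsys.interarrival_law (f i).1 (f i).2
    have hy := hsys.service_law (f i).1
    have h3 : IndepFun (fun ω => T ((f i).1 + 1) ω - T (f i).1 ω) (S (f i).1) P :=
      hind.comp (measurable_pi_apply i) (measurable_pi_apply i)
    rw [(indepFun_iff_map_prod_eq_prod_map_map hx.aemeasurable_snd hy.aemeasurable_snd).1 hXY,
      ← hx.map_eq, ← hy.map_eq]
    exact (indepFun_iff_map_prod_eq_prod_map_map hx.aemeasurable_fst hy.aemeasurable_fst).1 h3
  exact h1.trans (congrArg Measure.infinitePi (funext h2))

/-- An almost sure property of an i.i.d. sequence of pairs holds along any sequence of distinct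
message numbers `≠ 0`. -/
lemma ae_of_ae_infinitePi (hsys : IsGIGISystem P T S Q X Y) (hXY : IndepFun X Y Q)
    {f : ℕ → {n : ℤ // n ≠ 0}} (hf : Function.Injective f) {p : (ℕ → ℝ × ℝ) → Prop}
    (hp : ∀ᵐ a ∂(Measure.infinitePi fun _ : ℕ => Q.map fun ω' => (X ω', Y ω')), p a) :
    ∀ᵐ ω ∂P, p fun i => (T ((f i).1 + 1) ω - T (f i).1 ω, S (f i).1 ω) := by
  rw [← hsys.map_eq_infinitePi hXY hf] at hp
  have hTm := hsys.measurable_arrival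
  have hSm := hsys.measurable_service
  exact ae_of_ae_map (Measurable.aemeasurable (by fun_prop)) hp

end IsGIGISystem

lemma injective_natCast_add_one :
    Function.Injective fun i : ℕ => (⟨i + 1, by lia⟩ : {n : ℤ // n ≠ 0}) := by
  intro i j hij
  simp only [Subtype.mk.injEq] at hij
  lia

lemma injective_neg_natCast_sub_one :
    Function.Injective fun i : ℕ => (⟨-i - 1, by lia⟩ : {n : ℤ // n ≠ 0}) := by
  intro i j hij
  simp only [Subtype.mk.injEq] at hij
  lia

namespace IsGIGISystem

lemma ae_isRegularPath (hsys : IsGIGISystem P T S Q X Y) (hXY : IndepFun X Y Q)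
    (hXpos : ∀ᵐ ω' ∂Q, 0 < X ω') (hXint : Integrable X Q) (hYpos : ∀ᵐ ω' ∂Q, 0 < Y ω')
    (hYm : AEMeasurable Y Q) (hsucc : 0 < Q.real {ω' | Y ω' < X ω'}) :
    ∀ᵐ ω ∂P, IsRegularPath (fun n => T n ω) fun n => S n ω := by
  have hm : AEMeasurable (fun ω' => (X ω', Y ω')) Q := hXint.aemeasurable.prodMk hYm
  have := Measure.isProbabilityMeasure_map hm
  have hEX := integral_pos_of_ae_pos hXpos hXint
  have hfst : Integrable (fun a : ℝ × ℝ => a.1) (Q.map fun ω' => (X ω', Y ω')) :=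
    (integrable_map_measure measurable_fst.aestronglyMeasurable hm).2 hXint
  have hfst' : ∫ a : ℝ × ℝ, a.1 ∂(Q.map fun ω' => (X ω', Y ω')) = ∫ ω', X ω' ∂Q :=
    integral_map hm measurable_fst.aestronglyMeasurable
  have hp : 0 < (Q.map fun ω' => (X ω', Y ω')).real {a | a.2 < a.1} := by
    rwa [map_measureReal_apply_of_aemeasurable hm (measurableSet_lt measurable_snd measurable_fst)]
  have hslln := ae_tendsto_sum_div measurable_fst hfst
  have hX : ∀ᵐ ω ∂P, ∀ n : ℤ, n ≠ 0 → T n ω < T (n + 1) ω :=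
    ae_all_iff.2 fun n => by
      by_cases hn : n = 0
      · simp [hn]
      · exact ((hsys.interarrival_law n hn).symm.ae_snd measurableSet_Ioi hXpos).mono
          fun ω h _ => sub_pos.1 h
  have hS : ∀ᵐ ω ∂P, ∀ n : ℤ, 0 < S n ω :=
    ae_all_iff.2 fun n => (hsys.service_law n).symm.ae_snd measurableSet_Ioi hYpos
  filter_upwards [hX, hS, hsys.origin, hsys.ae_of_ae_infinitePi hXY injective_natCast_add_one hslln,
    hsys.ae_of_ae_infinitePi hXY injective_neg_natCast_sub_one hslln,
    hsys.ae_of_ae_infinitePi hXY injective_neg_natCast_sub_one (ae_exists_success_ge hp)]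
    with ω hX hS h01 hright hleft hex
  have hmono : StrictMono fun n => T n ω := strictMono_int_of_lt_succ fun n => by
    by_cases hn : n = 0
    · subst hn; exact h01.1.trans_lt h01.2
    · exact hX n hn
  rw [hfst'] at hright hleft
  have hinfty : ∀ {u : ℕ → ℝ}, Tendsto (fun n : ℕ => u n / n) atTop (𝓝 (∫ ω', X ω' ∂Q)) →
      Tendsto u atTop atTop := fun {u} hu => by
    refine (Tendsto.pos_mul_atTop hEX hu tendsto_natCast_atTop_atTop).congr' ?_
    filter_upwards [eventually_gt_atTop 0] with n hn
    exact div_mul_cancel₀ _ (by exact_mod_cast hn.ne')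
  have hsum2 : ∀ n : ℕ, ∑ i ∈ Finset.range n, (T (-(i : ℤ) - 1 + 1) ω - T (-(i : ℤ) - 1) ω) =
      T 0 ω - T (-n) ω := fun n => by
    have := Finset.sum_range_sub' (fun i : ℕ => T (-(i : ℤ)) ω) n
    simp only [Nat.cast_zero, neg_zero] at this
    rw [← this]
    refine Finset.sum_congr rfl fun i _ => ?_
    push_cast
    ring_nf
  simp only [sum_interarrival_eq_sub] at hright
  simp only [hsum2] at hleft
  refine ⟨hmono, ?_, ?_, hS, fun m => ?_⟩
  · refine tendsto_atTop_atTop_of_monotone hmono.monotone fun b => ?_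
    obtain ⟨n, hn⟩ := ((hinfty hright).eventually (eventually_ge_atTop (b - T 1 ω))).exists
    exact ⟨n + 1, by linarith⟩
  · refine tendsto_atBot_atBot_of_monotone hmono.monotone fun b => ?_
    obtain ⟨n, hn⟩ := ((hinfty hleft).eventually (eventually_ge_atTop (T 0 ω - b))).exists
    exact ⟨-n, by linarith⟩
  · obtain ⟨n, hn, hlt⟩ := hex (-m).toNat
    exact ⟨-(n : ℤ) - 1, by lia, by linarith⟩

/-- The time averages of the relative age converge almost surely. -/
theorem ae_tendsto_time_average (hsys : IsGIGISystem P T S Q X Y) (hXY : IndepFun X Y Q)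
    (hXpos : ∀ᵐ ω' ∂Q, 0 < X ω') (hXint : Integrable X Q) (hYpos : ∀ᵐ ω' ∂Q, 0 < Y ω')
    (hYint : Integrable Y Q) (hsucc : 0 < Q.real {ω' | Y ω' < X ω'}) :
    ∀ᵐ ω ∂P, Tendsto
      (fun t : ℝ => (∫ u in (0 : ℝ)..t, relativeAge (fun n => T n ω) (fun n => S n ω) u) / t) atTop
      (𝓝 ((∫ ω', min (X ω') (Y ω') ∂Q) / Q.real {ω' | Y ω' < X ω'})) := by
  have hm : AEMeasurable (fun ω' => (X ω', Y ω')) Q := hXint.aemeasurable.prodMk hYint.aemeasurable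
  have := Measure.isProbabilityMeasure_map hm
  have hEX := integral_pos_of_ae_pos hXpos hXint
  have hfst : Integrable (fun a : ℝ × ℝ => a.1) (Q.map fun ω' => (X ω', Y ω')) :=
    (integrable_map_measure measurable_fst.aestronglyMeasurable hm).2 hXint
  have hsnd : Integrable (fun a : ℝ × ℝ => a.2) (Q.map fun ω' => (X ω', Y ω')) :=
    (integrable_map_measure measurable_snd.aestronglyMeasurable hm).2 hYint
  have hfst' : ∫ a : ℝ × ℝ, a.1 ∂(Q.map fun ω' => (X ω', Y ω')) = ∫ ω', X ω' ∂Q :=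
    integral_map hm measurable_fst.aestronglyMeasurable
  have hbusy : ∫ a, busyTime a ∂(Q.map fun ω' => (X ω', Y ω')) = ∫ ω', min (X ω') (Y ω') ∂Q :=
    integral_map hm measurable_busyTime.aestronglyMeasurable
  have hset : (Q.map fun ω' => (X ω', Y ω')).real {a | a.2 < a.1} =
      Q.real {ω' | Y ω' < X ω'} := by
    rw [map_measureReal_apply_of_aemeasurable hm (measurableSet_lt measurable_snd measurable_fst)]
    rfl
  have hpos : ∀ᵐ a ∂(Q.map fun ω' => (X ω', Y ω')), 0 < a.1 ∧ 0 < a.2 := by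
    exact (ae_map_iff hm ((measurableSet_lt measurable_const measurable_fst).inter
      (measurableSet_lt measurable_const measurable_snd))).2 (hXpos.and hYpos)
  have havg := ae_tendsto_age_average hpos hfst hsnd (hset ▸ hsucc)
  rw [hfst', hbusy, hset] at havg
  filter_upwards [hsys.ae_isRegularPath hXY hXpos hXint hYpos hYint.aemeasurable hsucc,
    hsys.ae_of_ae_infinitePi hXY injective_natCast_add_one havg,
    hsys.ae_of_ae_infinitePi hXY injective_natCast_add_one
      (ae_tendsto_sum_div measurable_fst hfst)] with ω hreg havg hslln
  rw [hfst'] at hslln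
  simp only [sum_interarrival_eq_sub] at hslln
  have h1 := havg
    (fun i => relativeAge (fun n => T n ω) (fun n => S n ω) (T ((i : ℤ) + 1) ω))
    (hreg.relativeAge_nonneg _) fun n => by
      push_cast
      exact hreg.relativeAge_arrival_succ _
  have h2 := hreg.tendsto_time_average hEX h1 hslln
  rwa [mul_div_cancel_left₀ _ hEX.ne'] at h2

end IsGIGISystem

end System

/-! ### The stationary mean -/

lemma measurable_relativeAge {α : Type*} [MeasurableSpace α] {T S : ℤ → α → ℝ} {τ : α → ℝ}
    (hT : ∀ n, Measurable (T n)) (hS : ∀ n, Measurable (S n)) (hτ : Measurable τ)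
    (h : ∀ a, IsRegularPath (fun n => T n a) fun n => S n a) :
    Measurable fun a => relativeAge (fun n => T n a) (fun n => S n a) (τ a) := by
  have hA : ∀ {σ : α → ℝ}, Measurable σ →
      Measurable fun a => lastArrival (fun n => T n a) (σ a) := fun {σ} hσ => by
    refine measurable_of_Ioi fun c => ?_
    have : (fun a => lastArrival (fun n => T n a) (σ a)) ⁻¹' Set.Ioi c =
        ⋃ n, {a | c < T n a} ∩ {a | T n a ≤ σ a} := by
      ext a
      have hg := (h a).isGreatest_lastArrival (σ a)
      simp only [Set.mem_preimage, Set.mem_Ioi, Set.mem_iUnion, Set.mem_inter_iff,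
        Set.mem_ofPred_eq]
      constructor
      · intro hc
        obtain ⟨n, hn⟩ := hg.1.1
        exact ⟨n, hn ▸ hc, hn ▸ hg.1.2⟩
      · rintro ⟨n, hc, hn⟩
        exact hc.trans_le (hg.2 ⟨⟨n, rfl⟩, hn⟩)
    rw [this]
    exact .iUnion fun n => (measurableSet_lt measurable_const (hT n)).inter
      (measurableSet_le (hT n) hσ)
  have hD : Measurable fun a => lastDeparture (fun n => T n a) (fun n => S n a) (τ a) := by
    refine measurable_of_Ioi fun c => ?_
    have : (fun a => lastDeparture (fun n => T n a) (fun n => S n a) (τ a)) ⁻¹' Set.Ioi c =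
        ⋃ n, {a | T n a + S n a < T (n + 1) a} ∩
          ({a | c < T n a + S n a} ∩ {a | T n a + S n a ≤ τ a}) := by
      ext a
      have hg := (h a).isGreatest_lastDeparture (τ a)
      simp only [Set.mem_preimage, Set.mem_Ioi, Set.mem_iUnion, Set.mem_inter_iff,
        Set.mem_ofPred_eq]
      constructor
      · intro hc
        obtain ⟨n, hs, hn⟩ := hg.1.1
        exact ⟨n, hs, hn ▸ hc, hn ▸ hg.1.2⟩
      · rintro ⟨n, hs, hc, hn⟩
        exact hc.trans_le (hg.2 ⟨⟨n, hs, rfl⟩, hn⟩)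
    rw [this]
    exact .iUnion fun n => (measurableSet_lt ((hT n).add (hS n)) (hT (n + 1))).inter
      ((measurableSet_lt measurable_const ((hT n).add (hS n))).inter
        (measurableSet_le ((hT n).add (hS n)) hτ))
  exact (hA hτ).sub (hA hD)

lemma isRegularPath_intCast : IsRegularPath (fun n : ℤ => (n : ℝ)) fun _ => 1 / 2 where
  strictMono := Int.cast_strictMono
  tendsto_atTop := tendsto_intCast_atTop_atTop
  tendsto_atBot := tendsto_intCast_atBot_iff.2 tendsto_id
  service_pos _ := by norm_num
  exists_success_lt m := ⟨m - 1, by lia, by push_cast; linarith⟩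

/-- If the one-dimensional laws of a nonnegative process do not depend on time and its time averages
converge almost surely to a constant, then that constant is its mean. Fatou's lemma bounds the
constant by the mean. Conversely, the mean of the process truncated at level `k` is the mean of its
time averages, which are at most the truncated time averages of the process. -/
lemma lintegral_eq_of_tendsto_time_average {Ω : Type*} [MeasurableSpace Ω] {P : Measure Ω}
    [IsProbabilityMeasure P] {z : Ω → ℝ → ENNReal} (hz : Measurable (Function.uncurry z))
    (hlaw : ∀ t, P.map (fun ω => z ω t) = P.map (fun ω => z ω 0)) {C : ENNReal}
    (hlim : ∀ᵐ ω ∂P, Tendsto (fun n : ℕ => (∫⁻ t in Set.Ioc (0 : ℝ) n, z ω t) / n) atTop (𝓝 C))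
    (t : ℝ) : ∫⁻ ω, z ω t ∂P = C := by
  have hzt : ∀ t, Measurable fun ω => z ω t := fun t =>
    hz.comp (measurable_id.prodMk measurable_const)
  have hφ : ∀ {φ : ENNReal → ENNReal}, Measurable φ → ∀ s,
      ∫⁻ ω, φ (z ω s) ∂P = ∫⁻ ω, φ (z ω t) ∂P := fun {φ} hφ s => by
    rw [← lintegral_map hφ (hzt s), ← lintegral_map hφ (hzt t), hlaw, hlaw t]
  have hmeas : ∀ {φ : ENNReal → ENNReal}, Measurable φ → ∀ n : ℕ,
      Measurable fun ω => ∫⁻ s in Set.Ioc (0 : ℝ) n, φ (z ω s) := fun {φ} hφm n =>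
    (hφm.comp hz).lintegral_prod_right'
  have havg : ∀ {φ : ENNReal → ENNReal}, Measurable φ → ∀ n : ℕ, 0 < n →
      ∫⁻ ω, (∫⁻ s in Set.Ioc (0 : ℝ) n, φ (z ω s)) / n ∂P = ∫⁻ ω, φ (z ω t) ∂P :=
    fun {φ} hφm n hn => by
      have hn0 : (n : ENNReal) ≠ 0 := by exact_mod_cast hn.ne'
      simp_rw [div_eq_mul_inv]
      rw [lintegral_mul_const _ (hmeas hφm n), lintegral_lintegral_swap
        (f := fun ω s => φ (z ω s)) (hφm.comp hz).aemeasurable,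
        lintegral_congr fun s => hφ hφm s, lintegral_const]
      simp only [Measure.restrict_apply MeasurableSet.univ, Set.univ_inter, Real.volume_Ioc,
        sub_zero, ENNReal.ofReal_natCast]
      rw [mul_assoc, ENNReal.mul_inv_cancel hn0 (ENNReal.natCast_ne_top n), mul_one]
  refine le_antisymm ?_ ?_
  · have htrunc : ∀ k : ℕ, ∫⁻ ω, min (z ω t) k ∂P ≤ C := fun k => by
      have hmin : Measurable fun x : ENNReal => min x k := measurable_id.min measurable_const
      have h1 : Tendsto
          (fun n : ℕ => ∫⁻ ω, min ((∫⁻ s in Set.Ioc (0 : ℝ) n, z ω s) / n) k ∂P) atTop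
          (𝓝 (∫⁻ _, min C k ∂P)) := by
        refine tendsto_lintegral_of_dominated_convergence (fun _ => (k : ENNReal))
          (fun n => ((hmeas measurable_id n).div_const _).min measurable_const)
          (fun n => ae_of_all _ fun ω => min_le_right _ _) (by simp) ?_
        filter_upwards [hlim] with ω hω
        exact hω.min tendsto_const_nhds
      rw [lintegral_const, measure_univ, mul_one] at h1
      refine (ge_of_tendsto h1 ?_).trans (min_le_left _ _)
      filter_upwards [eventually_gt_atTop 0] with n hn
      have hn0 : (n : ENNReal) ≠ 0 := by exact_mod_cast hn.ne'
      rw [← havg hmin n hn]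
      refine lintegral_mono fun ω => le_min ?_ ?_
      · gcongr
        exact min_le_left _ _
      · rw [ENNReal.div_le_iff hn0 (ENNReal.natCast_ne_top n)]
        refine (lintegral_mono fun s => min_le_right (z ω s) (k : ENNReal)).trans ?_
        simp
    have h2 : ∀ x : ENNReal, Tendsto (fun k : ℕ => min x (k : ENNReal)) atTop (𝓝 x) := fun x => by
      have := (tendsto_const_nhds (x := x)).min ENNReal.tendsto_nat_nhds_top
      simpa using this
    calc ∫⁻ ω, z ω t ∂P = ∫⁻ ω, liminf (fun k : ℕ => min (z ω t) (k : ENNReal)) atTop ∂P :=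
          lintegral_congr fun ω => (h2 _).liminf_eq.symm
      _ ≤ liminf (fun k : ℕ => ∫⁻ ω, min (z ω t) (k : ENNReal) ∂P) atTop :=
          lintegral_liminf_le fun k => (hzt t).min measurable_const
      _ ≤ C := liminf_le_of_le (by isBoundedDefault) fun b hb => by
          obtain ⟨k, hk⟩ := hb.exists
          exact hk.trans (htrunc k)
  · calc C = ∫⁻ _, C ∂P := by simp
      _ = ∫⁻ ω, liminf (fun n : ℕ => (∫⁻ s in Set.Ioc (0 : ℝ) n, z ω s) / n) atTop ∂P :=
          lintegral_congr_ae (hlim.mono fun ω hω => hω.liminf_eq.symm)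
      _ ≤ liminf (fun n : ℕ => ∫⁻ ω, (∫⁻ s in Set.Ioc (0 : ℝ) n, z ω s) / n ∂P) atTop :=
          lintegral_liminf_le fun n => (hmeas measurable_id n).div_const _
      _ ≤ ∫⁻ ω, z ω t ∂P := liminf_le_of_le (by isBoundedDefault) fun b hb => by
          obtain ⟨n, hn, hn0⟩ := (hb.and (eventually_gt_atTop 0)).exists
          exact hn.trans_eq (havg measurable_id n hn0)

/-- The mean of a stationary relative age is the almost sure limit of its time averages. -/
lemma integral_relativeAge_of_stationary {Ω : Type*} [MeasurableSpace Ω] {P : Measure Ω}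
    [IsProbabilityMeasure P] {T S : ℤ → Ω → ℝ} (hT : ∀ n, Measurable (T n))
    (hS : ∀ n, Measurable (S n))
    (hreg : ∀ᵐ ω ∂P, IsRegularPath (fun n => T n ω) fun n => S n ω) {c : ℝ}
    (hlim : ∀ᵐ ω ∂P, Tendsto
      (fun t : ℝ => (∫ u in (0 : ℝ)..t, relativeAge (fun n => T n ω) (fun n => S n ω) u) / t) atTop
      (𝓝 c))
    (hstat : IsStationaryProcess P
      fun t ω => relativeAge (fun n => T n ω) (fun n => S n ω) t) (t : ℝ) :
    Integrable (fun ω => relativeAge (fun n => T n ω) (fun n => S n ω) t) P ∧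
      ∫ ω, relativeAge (fun n => T n ω) (fun n => S n ω) t ∂P = c := by
  classical
  -- On a null set the paths are replaced by a fixed regular one, which makes the relative age
  -- jointly measurable; otherwise the path law in `hstat` could be a junk value.
  obtain ⟨G, hG, hGm, hGreg⟩ := hreg.exists_measurable_mem
  set T' : ℤ → Ω → ℝ := fun n ω => if ω ∈ G then T n ω else n with hT'
  set S' : ℤ → Ω → ℝ := fun n ω => if ω ∈ G then S n ω else 1 / 2 with hS'
  have hT'm : ∀ n, Measurable (T' n) := fun n => Measurable.ite hGm (hT n) measurable_const
  have hS'm : ∀ n, Measurable (S' n) := fun n => Measurable.ite hGm (hS n) measurable_const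
  have hreg' : ∀ ω, IsRegularPath (fun n => T' n ω) fun n => S' n ω := fun ω => by
    by_cases hω : ω ∈ G
    · simpa [hT', hS', hω] using hGreg ω hω
    · simpa [hT', hS', hω] using isRegularPath_intCast
  set Z : Ω → ℝ → ℝ := fun ω t => relativeAge (fun n => T' n ω) (fun n => S' n ω) t with hZ
  have hZm : Measurable (Function.uncurry Z) :=
    measurable_relativeAge (T := fun n (a : Ω × ℝ) => T' n a.1) (S := fun n a => S' n a.1)
      (fun n => (hT'm n).comp measurable_fst) (fun n => (hS'm n).comp measurable_fst)
      measurable_snd fun a => hreg' a.1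
  have hZt : ∀ t, Measurable fun ω => Z ω t := fun t =>
    hZm.comp (measurable_id.prodMk measurable_const)
  have hZ0 : ∀ ω t, 0 ≤ Z ω t := fun ω t => (hreg' ω).relativeAge_nonneg t
  have hZeq : ∀ᵐ ω ∂P, relativeAge (fun n => T n ω) (fun n => S n ω) = Z ω := by
    filter_upwards [hG] with ω hω
    simp [hZ, hT', hS', hω]
  have hlaw : ∀ t, P.map (fun ω => Z ω t) = P.map (fun ω => Z ω 0) := fun t => by
    have h1 := hstat t
    rw [Measure.map_congr (g := fun ω s => Z ω (s + t))
        (hZeq.mono fun ω hω => funext fun s => congrFun hω (s + t)),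
      Measure.map_congr (g := fun ω s => Z ω s) (hZeq.mono fun ω hω => hω)] at h1
    have h2 := congrArg (Measure.map fun p : ℝ → ℝ => p 0) h1
    rw [Measure.map_map (by fun_prop) (by fun_prop),
      Measure.map_map (by fun_prop) (by fun_prop)] at h2
    simpa [Function.comp_def] using h2
  have hlaw' : ∀ t, P.map (fun ω => ENNReal.ofReal (Z ω t)) =
      P.map (fun ω => ENNReal.ofReal (Z ω 0)) := fun t => by
    have h := congrArg (Measure.map ENNReal.ofReal) (hlaw t)
    rwa [Measure.map_map ENNReal.measurable_ofReal (hZt t),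
      Measure.map_map ENNReal.measurable_ofReal (hZt 0)] at h
  have hlim' : ∀ᵐ ω ∂P, Tendsto
      (fun n : ℕ => (∫⁻ t in Set.Ioc (0 : ℝ) n, ENNReal.ofReal (Z ω t)) / n) atTop
      (𝓝 (ENNReal.ofReal c)) := by
    filter_upwards [hlim, hZeq] with ω hω hωZ
    rw [hωZ] at hω
    refine (ENNReal.tendsto_ofReal (hω.comp tendsto_natCast_atTop_atTop)).congr' ?_
    filter_upwards [eventually_gt_atTop 0] with n hn
    have hn0 : (0 : ℝ) < n := by exact_mod_cast hn
    simp only [Function.comp_apply]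
    rw [ENNReal.ofReal_div_of_pos hn0, ENNReal.ofReal_natCast,
      intervalIntegral.integral_of_le hn0.le,
      ofReal_integral_eq_lintegral_ofReal ?_ (ae_of_all _ (hZ0 ω))]
    exact ((hreg' ω).intervalIntegrable_relativeAge 0 n).1
  have hmain := lintegral_eq_of_tendsto_time_average (z := fun ω t => ENNReal.ofReal (Z ω t))
    (ENNReal.measurable_ofReal.comp hZm) hlaw' hlim' t
  have hc : 0 ≤ c := by
    obtain ⟨ω, hω, hωZ⟩ := (hlim.and hZeq).exists
    rw [hωZ] at hω
    refine ge_of_tendsto hω ?_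
    filter_upwards [eventually_ge_atTop 0] with t ht
    exact div_nonneg (intervalIntegral.integral_nonneg ht fun u _ => hZ0 ω u) ht
  have hZt_eq : (fun ω => relativeAge (fun n => T n ω) (fun n => S n ω) t) =ᵐ[P]
      fun ω => Z ω t := hZeq.mono fun ω hω => congrFun hω t
  have hint : Integrable (fun ω => Z ω t) P := by
    refine ⟨(hZt t).aestronglyMeasurable, ?_⟩
    rw [hasFiniteIntegral_iff_ofReal (ae_of_all _ fun ω => hZ0 ω t), hmain]
    exact ENNReal.ofReal_lt_top
  refine ⟨hint.congr hZt_eq.symm, ?_⟩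
  rw [integral_congr_ae hZt_eq, integral_eq_lintegral_of_nonneg_ae
    (ae_of_all _ fun ω => hZ0 ω t) (hZt t).aestronglyMeasurable, hmain, ENNReal.toReal_ofReal hc]

theorem proposition1
    {Ω' : Type*} [MeasurableSpace Ω'] (Q : Measure Ω') [IsProbabilityMeasure Q]
    (X Y : Ω' → ℝ) (hXY : IndepFun X Y Q)
    (hXpos : ∀ᵐ ω' ∂Q, 0 < X ω') (hXint : Integrable X Q)
    (hYpos : ∀ᵐ ω' ∂Q, 0 < Y ω') (hYint : Integrable Y Q)
    (hsucc : 0 < Q.real {ω' | Y ω' < X ω'})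
    {Ω : Type*} [MeasurableSpace Ω] (P : Measure Ω) [IsProbabilityMeasure P]
    (T S : ℤ → Ω → ℝ) (hsys : IsGIGISystem P T S Q X Y) :
    (∀ᵐ ω ∂P,
      (∀ t : ℝ, 0 ≤ t →
        IntervalIntegrable (relativeAge (fun n => T n ω) (fun n => S n ω)) volume 0 t) ∧
      Tendsto
        (fun t : ℝ => (∫ u in (0 : ℝ)..t, relativeAge (fun n => T n ω) (fun n => S n ω) u) / t)
        atTop
        (𝓝 ((∫ ω', min (X ω') (Y ω') ∂Q) / Q.real {ω' | Y ω' < X ω'}))) ∧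
    (IsStationaryProcess P (fun t ω => relativeAge (fun n => T n ω) (fun n => S n ω) t) →
      ∀ t : ℝ,
        Integrable (fun ω => relativeAge (fun n => T n ω) (fun n => S n ω) t) P ∧
        ∫ ω, relativeAge (fun n => T n ω) (fun n => S n ω) t ∂P =
          (∫ ω', min (X ω') (Y ω') ∂Q) / Q.real {ω' | Y ω' < X ω'}) := by
  have havg := hsys.ae_tendsto_time_average hXY hXpos hXint hYpos hYint hsucc
  have hreg := hsys.ae_isRegularPath hXY hXpos hXint hYpos hYint.aemeasurable hsucc
  refine ⟨?_, fun hstat => integral_relativeAge_of_stationary hsys.measurable_arrival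
    hsys.measurable_service hreg havg hstat⟩
  filter_upwards [hreg, havg] with ω h1 h2
  exact ⟨fun t _ => h1.intervalIntegrable_relativeAge 0 t, h2⟩
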